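/- Let $I$ be a finite set with $n$ elements, $A=(a_{ij})_{i,j\in I}$ a complex matrix and $p:I\to\mathbb{Z}/2$ a parity function. Let $\mathfrak h$ be a complex vector space of dimension $2n-\operatorname{rk}A$ with linearly independent $\alpha_i\in\mathfrak h^*$ and linearly independent $h_i\in\mathfrak h$ ($i\in I$) such that $\alpha_j(h_i)=a_{ij}$. Let $\tilde{\mathfrak g}(A)$ be the complex Lie superalgebra generated by the vector space $\mathfrak h$ (even) and elements $X_i,Y_i$ ($i\in I$) of parity $p(i)$, with relations $$[h,h']=0,\quad [X_i,Y_j]=\delta_{ij}h_i,\quad [h,X_i]=\alpha_i(h)X_i,\quad [h,Y_i]=-\alpha_i(h)Y_i\qquad(h,h'\in\mathfrak h,\ i,j\in I),$$ let $r(A)$ be the maximal ideal of $\tilde{\mathfrak g}(A)$ which intersects $\mathfrak h$ trivially, and let $\mathfrak g(A)=\tilde{\mathfrak g}(A)/r(A)$ be the contragredient Lie superalgebra of $A$. Its principal grading is $\mathfrak g(A)=\bigoplus_{m\in\mathbb Z}\mathfrak g_m$, where $\mathfrak g_m$ is the sum of the weight spaces $\{x : [h,x]=\mu(h)x \text{ for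 all } h\in\mathfrak h\}$ over all $\mu=\sum_i c_i\alpha_i$ with $c_i\in\mathbb Z$ and $\sum_i c_i=m$. We say that $\mathfrak g(A)$ has finite growth if $\dim\mathfrak g_m$ is bounded by a polynomial in $|m|$, and that it is integrable if for every $i\in I$ the operator $\operatorname{ad}_{X_i}$ is locally nilpotent on $\mathfrak g(A)$, i.e. for every $x\in\mathfrak g(A)$ there is $k$ with $(\operatorname{ad}_{X_i})^k x=0$. **Theorem.** If $A$ has no zero rows and $\mathfrak g(A)$ has finite growth, then $\mathfrak g(A)$ is integrable. -/

import Mathlib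

noncomputable section

/-- A superalgebra over `ℂ`: a vector space `L = L₀ ⊕ L₁` with a bilinear product
`bracket` which is compatible with the `ℤ/2`-grading. -/
class Superalgebra (L : Type*) [AddCommGroup L] [Module ℂ L] where
  bracket : L →ₗ[ℂ] L →ₗ[ℂ] L
  part : ZMod 2 → Submodule ℂ L
  isCompl : IsCompl (part 0) (part 1)
  bracket_mem : ∀ (a b : ZMod 2) (x y : L),
    x ∈ part a → y ∈ part b → bracket x y ∈ part (a + b)

/-- The sign `(-1)^(a b)`. -/
def superSign (a b : ZMod 2) : ℂ := (-1) ^ (a * b).val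

/-- A superalgebra is a Lie superalgebra if its product satisfies super skew-symmetry and the
super Jacobi identity. -/
class IsLieSuperalgebra (L : Type*) [AddCommGroup L] [Module ℂ L] [Superalgebra L] :
    Prop where
  skew : ∀ (a b : ZMod 2) (x y : L), x ∈ Superalgebra.part a → y ∈ Superalgebra.part b →
    Superalgebra.bracket x y = -(superSign a b • Superalgebra.bracket y x)
  jacobi : ∀ (a b : ZMod 2) (x y z : L), x ∈ Superalgebra.part a → y ∈ Superalgebra.part b →
    Superalgebra.bracket x (Superalgebra.bracket y z) =
      Superalgebra.bracket (Superalgebra.bracket x y) z +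
        superSign a b • Superalgebra.bracket y (Superalgebra.bracket x z)

namespace Superalgebra

section Ideals

variable {L : Type*} [AddCommGroup L] [Module ℂ L] [Superalgebra L]

/-- A (two-sided, `ℤ/2`-graded) ideal of a superalgebra. -/
structure IsIdeal (J : Submodule ℂ L) : Prop where
  left : ∀ x y : L, y ∈ J → bracket x y ∈ J
  right : ∀ x y : L, x ∈ J → bracket x y ∈ J
  graded : ∀ x ∈ J, ∃ y ∈ J, ∃ z ∈ J, y ∈ part 0 ∧ z ∈ part 1 ∧ x = y + z

theorem eq_of_add_eq {y z y' z' : L} (hy : y ∈ part (L := L) 0) (hy' : y' ∈ part (L := L) 0)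
    (hz : z ∈ part (L := L) 1) (hz' : z' ∈ part (L := L) 1) (h : y + z = y' + z') :
    y = y' ∧ z = z' := by
  have e : y - y' = z' - z := by
    rw [sub_eq_sub_iff_add_eq_add, h, add_comm]
  have h1 : y - y' ∈ part (L := L) 0 := Submodule.sub_mem _ hy hy'
  have h2 : y - y' ∈ part (L := L) 1 := e ▸ Submodule.sub_mem _ hz' hz
  have h0 : y - y' = 0 := (Submodule.disjoint_def.mp (isCompl (L := L)).disjoint) _ h1 h2
  exact ⟨sub_eq_zero.mp h0, (sub_eq_zero.mp (e ▸ h0)).symm⟩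

theorem isIdeal_sInf {S : Set (Submodule ℂ L)} (hS : ∀ J ∈ S, IsIdeal J) :
    IsIdeal (sInf S) where
  left x y hy := by
    rw [Submodule.mem_sInf] at hy ⊢
    exact fun J hJ => (hS J hJ).left x y (hy J hJ)
  right x y hx := by
    rw [Submodule.mem_sInf] at hx ⊢
    exact fun J hJ => (hS J hJ).right x y (hx J hJ)
  graded x hx := by
    rw [Submodule.mem_sInf] at hx
    have ht : x ∈ part (L := L) 0 ⊔ part 1 := by
      rw [(isCompl (L := L)).sup_eq_top]; trivial
    obtain ⟨y, hy, z, hz, rfl⟩ := Submodule.mem_sup.mp ht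
    have key : ∀ J ∈ S, y ∈ J ∧ z ∈ J := by
      intro J hJ
      obtain ⟨y', hyJ, z', hzJ, hy', hz', e⟩ := (hS J hJ).graded _ (hx J hJ)
      obtain ⟨rfl, rfl⟩ := eq_of_add_eq hy hy' hz hz' e
      exact ⟨hyJ, hzJ⟩
    exact ⟨y, Submodule.mem_sInf.mpr fun J hJ => (key J hJ).1,
      z, Submodule.mem_sInf.mpr fun J hJ => (key J hJ).2, hy, hz, rfl⟩

theorem isIdeal_sSup {S : Set (Submodule ℂ L)} (hS : ∀ J ∈ S, IsIdeal J) :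
    IsIdeal (sSup S) where
  left x y hy := by
    have h : sSup S ≤ (sSup S).comap (bracket x) :=
      sSup_le fun J hJ w hw => (le_sSup hJ : J ≤ sSup S) ((hS J hJ).left x w hw)
    exact h hy
  right x y hx := by
    have h : sSup S ≤ (sSup S).comap (bracket.flip y) :=
      sSup_le fun J hJ w hw => (le_sSup hJ : J ≤ sSup S) ((hS J hJ).right w y hw)
    exact h hx
  graded x hx := by
    have h : sSup S ≤ (sSup S ⊓ part 0) ⊔ (sSup S ⊓ part 1) := by
      refine sSup_le fun J hJ w hw => ?_
      obtain ⟨y, hyJ, z, hzJ, hy, hz, rfl⟩ := (hS J hJ).graded w hw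
      have hle : J ≤ sSup S := le_sSup hJ
      exact Submodule.add_mem_sup ⟨hle hyJ, hy⟩ ⟨hle hzJ, hz⟩
    obtain ⟨y, ⟨hy, hy'⟩, z, ⟨hz, hz'⟩, e⟩ := Submodule.mem_sup.mp (h hx)
    exact ⟨y, hy, z, hz, hy', hz', e.symm⟩

/-- The ideal generated by a set. -/
def idealSpan (S : Set L) : Submodule ℂ L :=
  sInf {J : Submodule ℂ L | IsIdeal J ∧ S ⊆ J}

theorem isIdeal_idealSpan (S : Set L) : IsIdeal (idealSpan S) :=
  isIdeal_sInf fun _ hJ => hJ.1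

theorem subset_idealSpan (S : Set L) : S ⊆ (idealSpan S : Set L) := fun _ hx =>
  Submodule.mem_sInf.mpr fun _ hJ => hJ.2 hx

/-- The quotient of a superalgebra by an ideal. -/
@[reducible]
def quotient (J : Submodule ℂ L) (hJ : IsIdeal J) : Superalgebra (L ⧸ J) where
  bracket := J.liftQ
    { toFun := fun x => J.mapQ J (bracket x) (hJ.left x)
      map_add' := fun x y => by
        refine Submodule.linearMap_qext _ (LinearMap.ext fun z => ?_); simp
      map_smul' := fun c x => by
        refine Submodule.linearMap_qext _ (LinearMap.ext fun z => ?_); simp }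
    (fun x hx => by
      rw [LinearMap.mem_ker]
      refine Submodule.linearMap_qext _ (LinearMap.ext fun z => ?_)
      simpa using hJ.right x z hx)
  part := fun a => (part a).map J.mkQ
  isCompl := by
    constructor
    · rw [Submodule.disjoint_def]
      rintro w ⟨y, hy, rfl⟩ ⟨z, hz, e⟩
      have hyz : y - z ∈ J := by
        have e' : (J.mkQ) (y - z) = 0 := by rw [map_sub, e, sub_self]
        exact (Submodule.Quotient.mk_eq_zero J).mp e'
      obtain ⟨y', hyJ, z', hzJ, hy', hz', e'⟩ := hJ.graded _ hyz
      rw [sub_eq_add_neg] at e'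
      obtain ⟨rfl, -⟩ := eq_of_add_eq hy hy' (Submodule.neg_mem _ hz) hz' e'
      simpa using hyJ
    · rw [codisjoint_iff, ← Submodule.map_sup, isCompl.sup_eq_top, Submodule.map_top,
        Submodule.range_mkQ]
  bracket_mem := by
    rintro a b _ _ ⟨x, hx, rfl⟩ ⟨y, hy, rfl⟩
    exact ⟨bracket x y, bracket_mem a b x y hx hy, by simp⟩

theorem isLie_quotient [IsLieSuperalgebra L] (J : Submodule ℂ L) (hJ : IsIdeal J) :
    let _ := quotient J hJ
    IsLieSuperalgebra (L ⧸ J) := by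
  let _ := quotient J hJ
  refine ⟨?_, ?_⟩
  · rintro a b _ _ ⟨x, hx, rfl⟩ ⟨y, hy, rfl⟩
    exact congrArg J.mkQ (IsLieSuperalgebra.skew a b x y hx hy)
  · rintro a b _ _ z ⟨x, hx, rfl⟩ ⟨y, hy, rfl⟩
    obtain ⟨z, rfl⟩ := J.mkQ_surjective z
    exact congrArg J.mkQ (IsLieSuperalgebra.jacobi a b x y z hx hy)

end Ideals

end Superalgebra

namespace Contragredient

open Superalgebra

/-- Generators of `g̃(A)`: symbols `X i`, `Y i` for `i : ι` and one symbol for every element of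
the vector space `H`. -/
inductive Gen (ι H : Type*) where
  | X (i : ι) : Gen ι H
  | Y (i : ι) : Gen ι H
  | h (v : H) : Gen ι H

/-- The parity of the generators. -/
def Gen.parity {ι H : Type*} (p : ι → ZMod 2) : Gen ι H → ZMod 2
  | .X i => p i
  | .Y i => p i
  | .h _ => 0

/-- The free nonassociative algebra on the generators; `p` is recorded since it determines the
`ℤ/2`-grading. -/
def Free {ι : Type*} (_p : ι → ZMod 2) (H : Type*) : Type _ :=
  FreeNonUnitalNonAssocAlgebra ℂ (Gen ι H)

section Free

variable {ι : Type*} (p : ι → ZMod 2) (H : Type*)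

instance : NonUnitalNonAssocRing (Free p H) :=
  inferInstanceAs (NonUnitalNonAssocRing (FreeNonUnitalNonAssocAlgebra ℂ (Gen ι H)))

instance : Module ℂ (Free p H) :=
  inferInstanceAs (Module ℂ (FreeNonUnitalNonAssocAlgebra ℂ (Gen ι H)))

instance : IsScalarTower ℂ (Free p H) (Free p H) :=
  inferInstanceAs (IsScalarTower ℂ (FreeNonUnitalNonAssocAlgebra ℂ (Gen ι H))
    (FreeNonUnitalNonAssocAlgebra ℂ (Gen ι H)))

instance : SMulCommClass ℂ (Free p H) (Free p H) :=
  inferInstanceAs (SMulCommClass ℂ (FreeNonUnitalNonAssocAlgebra ℂ (Gen ι H))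
    (FreeNonUnitalNonAssocAlgebra ℂ (Gen ι H)))

/-- The generators as elements of the free algebra. -/
def Free.gen (g : Gen ι H) : Free p H := FreeNonUnitalNonAssocAlgebra.of ℂ g

/-- `IsMonomial p H a x`: `x` is a nonassociative monomial in the generators, of parity `a`. -/
inductive Free.IsMonomial : ZMod 2 → Free p H → Prop
  | gen (g : Gen ι H) : IsMonomial (g.parity p) (Free.gen p H g)
  | mul {a b : ZMod 2} {x y : Free p H} :
      IsMonomial a x → IsMonomial b y → IsMonomial (a + b) (x * y)

/-- The homogeneous part of parity `a`: the span of the monomials of parity `a`. -/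
def Free.part (a : ZMod 2) : Submodule ℂ (Free p H) :=
  Submodule.span ℂ {x | Free.IsMonomial p H a x}

theorem neg_one_pow_val_add (a b : ZMod 2) :
    (-1 : ℂ) ^ (a.val + b.val) = (-1) ^ (a + b).val := by
  rw [neg_one_pow_eq_pow_mod_two, ZMod.val_add]

/-- The parity automorphism of the free algebra. -/
def Free.invol : Free p H →ₙₐ[ℂ] Free p H :=
  FreeNonUnitalNonAssocAlgebra.lift ℂ
    fun g : Gen ι H => ((-1 : ℂ) ^ (g.parity p).val) • Free.gen p H g

theorem Free.invol_monomial {a : ZMod 2} {x : Free p H} (hx : Free.IsMonomial p H a x) :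
    Free.invol p H x = ((-1 : ℂ) ^ a.val) • x := by
  induction hx with
  | gen g => exact FreeNonUnitalNonAssocAlgebra.lift_of_apply ℂ _ g
  | @mul a b x y _ _ ihx ihy =>
    rw [map_mul, ihx, ihy, smul_mul_smul_comm, ← pow_add]
    congr 1
    exact neg_one_pow_val_add a b

theorem Free.invol_part {a : ZMod 2} {x : Free p H} (hx : x ∈ Free.part p H a) :
    Free.invol p H x = ((-1 : ℂ) ^ a.val) • x := by
  induction hx using Submodule.span_induction with
  | mem x hx => exact Free.invol_monomial p H hx
  | zero => simp
  | add x y _ _ hx hy => rw [map_add, hx, hy, smul_add]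
  | smul c x _ hx => rw [map_smul, hx, smul_comm]

theorem Free.mul_mem_part {a b : ZMod 2} {x y : Free p H} (hx : x ∈ Free.part p H a)
    (hy : y ∈ Free.part p H b) : x * y ∈ Free.part p H (a + b) := by
  induction hx using Submodule.span_induction with
  | mem x hx =>
    induction hy using Submodule.span_induction with
    | mem y hy => exact Submodule.subset_span (.mul hx hy)
    | zero => simp
    | add y z _ _ h1 h2 => rw [mul_add]; exact add_mem h1 h2
    | smul c y _ h => rw [mul_smul_comm]; exact Submodule.smul_mem _ _ h
  | zero => simp
  | add x z _ _ h1 h2 => rw [add_mul]; exact add_mem h1 h2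
  | smul c x _ h => rw [smul_mul_assoc]; exact Submodule.smul_mem _ _ h

/-- The sum of the two homogeneous parts, as a subalgebra. -/
def Free.partSup : NonUnitalSubalgebra ℂ (Free p H) where
  toSubmodule := Free.part p H 0 ⊔ Free.part p H 1
  mul_mem' := by
    intro x y hx hy
    obtain ⟨x0, hx0, x1, hx1, rfl⟩ := Submodule.mem_sup.mp hx
    obtain ⟨y0, hy0, y1, hy1, rfl⟩ := Submodule.mem_sup.mp hy
    have h11 := Free.mul_mem_part p H hx1 hy1
    rw [show (1 : ZMod 2) + 1 = 0 from rfl] at h11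
    have h10 := Free.mul_mem_part p H hx1 hy0
    rw [add_zero] at h10
    rw [add_mul, mul_add, mul_add]
    exact add_mem
      (add_mem (Submodule.mem_sup_left (Free.mul_mem_part p H hx0 hy0))
        (Submodule.mem_sup_right (Free.mul_mem_part p H hx0 hy1)))
      (add_mem (Submodule.mem_sup_right h10)
        (Submodule.mem_sup_left h11))

theorem Free.gen_mem_partSup (g : Gen ι H) : Free.gen p H g ∈ Free.partSup p H := by
  have h := Submodule.subset_span (R := ℂ) (s := {x | Free.IsMonomial p H (g.parity p) x})
    (Free.IsMonomial.gen g)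
  have hz : g.parity p = 0 ∨ g.parity p = 1 := by
    generalize g.parity p = a
    revert a
    decide
  rcases hz with e | e <;> rw [e] at h
  · exact Submodule.mem_sup_left h
  · exact Submodule.mem_sup_right h

theorem Free.mem_sup (x : Free p H) : x ∈ Free.part p H 0 ⊔ Free.part p H 1 := by
  let f : Free p H →ₙₐ[ℂ] Free.partSup p H :=
    FreeNonUnitalNonAssocAlgebra.lift ℂ
      fun g : Gen ι H => ⟨Free.gen p H g, Free.gen_mem_partSup p H g⟩
  have hf : (NonUnitalSubalgebraClass.subtype (Free.partSup p H)).comp f =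
      NonUnitalAlgHom.id ℂ (Free p H) := by
    refine FreeNonUnitalNonAssocAlgebra.hom_ext (R := ℂ) fun g => ?_
    exact congrArg Subtype.val (FreeNonUnitalNonAssocAlgebra.lift_of_apply ℂ
      (fun g : Gen ι H =>
        (⟨Free.gen p H g, Free.gen_mem_partSup p H g⟩ : Free.partSup p H)) g)
  have hx : ((f x : Free.partSup p H) : Free p H) = x := DFunLike.congr_fun hf x
  exact hx ▸ (f x).2

instance : Superalgebra (Free p H) where
  bracket := LinearMap.mul ℂ (Free p H)
  part := Free.part p H
  isCompl := by
    constructor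
    · rw [Submodule.disjoint_def]
      intro x h0 h1
      have e0 := Free.invol_part p H h0
      have e1 := Free.invol_part p H h1
      rw [e0] at e1
      have v0 : (0 : ZMod 2).val = 0 := rfl
      have v1 : (1 : ZMod 2).val = 1 := rfl
      rw [v0, v1, pow_zero, pow_one, one_smul, neg_one_smul] at e1
      have e2 : (2 : ℂ) • x = 0 := by
        rw [two_smul]
        exact eq_neg_iff_add_eq_zero.mp e1
      exact (smul_eq_zero.mp e2).resolve_left two_ne_zero
    · rw [codisjoint_iff, eq_top_iff]
      exact fun x _ => Free.mem_sup p H x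
  bracket_mem := fun _ _ _ _ hx hy => Free.mul_mem_part p H hx hy

end Free

/-- A realization of the matrix `A` in the vector space `H`: `dim H = 2n - rk A`, together with
linearly independent `αⱼ ∈ H*` and linearly independent `hᵢ ∈ H` such that `αⱼ(hᵢ) = aᵢⱼ`. -/
structure Realization {ι : Type*} [Fintype ι] (A : Matrix ι ι ℂ)
    (H : Type*) [AddCommGroup H] [Module ℂ H] where
  finiteDimensional : FiniteDimensional ℂ H
  finrank_add_rank : Module.finrank ℂ H + A.rank = 2 * Fintype.card ι
  root : ι → Module.Dual ℂ H
  coroot : ι → H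
  root_indep : LinearIndependent ℂ root
  coroot_indep : LinearIndependent ℂ coroot
  root_coroot : ∀ i j, root j (coroot i) = A i j

section Construction

variable {ι : Type*} [Fintype ι] {A : Matrix ι ι ℂ} {H : Type*} [AddCommGroup H] [Module ℂ H]
  (p : ι → ZMod 2) (R : Realization A H)

open Free in
/-- The defining relations of `g̃(A)`, as elements of the free algebra that are to vanish. -/
inductive Rel : Free p H → Prop
  /- super skew-symmetry and super Jacobi identity -/
  | skew (a b : ZMod 2) (x y : Free p H) : x ∈ Free.part p H a → y ∈ Free.part p H b →
      Rel (x * y + superSign a b • (y * x))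
  | jacobi (a b : ZMod 2) (x y z : Free p H) : x ∈ Free.part p H a → y ∈ Free.part p H b →
      Rel (x * (y * z) - ((x * y) * z + superSign a b • (y * (x * z))))
  /- the generators `h v` depend linearly on `v ∈ H` and commute with each other -/
  | h_add (v w : H) : Rel (gen p H (.h (v + w)) - (gen p H (.h v) + gen p H (.h w)))
  | h_smul (c : ℂ) (v : H) : Rel (gen p H (.h (c • v)) - c • gen p H (.h v))
  | h_h (v w : H) : Rel (gen p H (.h v) * gen p H (.h w))
  /- the Chevalley relations -/
  | X_Y (i : ι) : Rel (gen p H (.X i) * gen p H (.Y i) - gen p H (.h (R.coroot i)))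
  | X_Y_ne (i j : ι) : i ≠ j → Rel (gen p H (.X i) * gen p H (.Y j))
  | h_X (v : H) (i : ι) :
      Rel (gen p H (.h v) * gen p H (.X i) - R.root i v • gen p H (.X i))
  | h_Y (v : H) (i : ι) :
      Rel (gen p H (.h v) * gen p H (.Y i) + R.root i v • gen p H (.Y i))

/-- The ideal of the free algebra generated by the defining relations. -/
def relIdeal : Submodule ℂ (Free p H) := idealSpan {x | Rel p R x}

/-- The Lie superalgebra `g̃(A)`. -/
def GTilde : Type _ := Free p H ⧸ relIdeal p R

instance : AddCommGroup (GTilde p R) := inferInstanceAs (AddCommGroup (Free p H ⧸ relIdeal p R))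

instance : Module ℂ (GTilde p R) := inferInstanceAs (Module ℂ (Free p H ⧸ relIdeal p R))

instance : Superalgebra (GTilde p R) :=
  Superalgebra.quotient (relIdeal p R) (isIdeal_idealSpan _)

/-- The image in `g̃(A)` of an element of the free algebra. -/
def GTilde.mk : Free p H →ₗ[ℂ] GTilde p R := (relIdeal p R).mkQ

theorem GTilde.mk_eq_zero {x : Free p H} (hx : Rel p R x) : GTilde.mk p R x = 0 :=
  (Submodule.Quotient.mk_eq_zero (relIdeal p R)).mpr (subset_idealSpan _ hx)

instance : IsLieSuperalgebra (GTilde p R) := by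
  refine ⟨?_, ?_⟩
  · rintro a b _ _ ⟨x, hx, rfl⟩ ⟨y, hy, rfl⟩
    have h := GTilde.mk_eq_zero p R (Rel.skew a b x y hx hy)
    rw [map_add, map_smul] at h
    exact eq_neg_of_add_eq_zero_left h
  · rintro a b _ _ z ⟨x, hx, rfl⟩ ⟨y, hy, rfl⟩
    obtain ⟨z, rfl⟩ := (relIdeal p R).mkQ_surjective z
    have h := GTilde.mk_eq_zero p R (Rel.jacobi a b x y z hx hy)
    rw [map_sub, map_add, map_smul] at h
    exact sub_eq_zero.mp h

/-- The canonical linear map `H → g̃(A)`. -/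
def GTilde.cartan : H →ₗ[ℂ] GTilde p R where
  toFun v := GTilde.mk p R (Free.gen p H (.h v))
  map_add' v w := by
    have h := GTilde.mk_eq_zero p R (Rel.h_add v w)
    rw [map_sub, map_add] at h
    exact sub_eq_zero.mp h
  map_smul' c v := by
    have h := GTilde.mk_eq_zero p R (Rel.h_smul c v)
    rw [map_sub, map_smul] at h
    exact sub_eq_zero.mp h

/-- The maximal ideal `r(A)` of `g̃(A)` which intersects the image of `H` trivially: the sum of
all ideals with this property. -/
def maxIdeal : Submodule ℂ (GTilde p R) :=
  sSup {J | IsIdeal J ∧ J ⊓ LinearMap.range (GTilde.cartan p R) = ⊥}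

theorem isIdeal_maxIdeal : IsIdeal (maxIdeal p R) :=
  isIdeal_sSup fun _ hJ => hJ.1

/-- The contragredient Lie superalgebra `g(A) = g̃(A) / r(A)`. -/
def G : Type _ := GTilde p R ⧸ maxIdeal p R

instance : AddCommGroup (G p R) := inferInstanceAs (AddCommGroup (GTilde p R ⧸ maxIdeal p R))

instance : Module ℂ (G p R) := inferInstanceAs (Module ℂ (GTilde p R ⧸ maxIdeal p R))

instance : Superalgebra (G p R) :=
  Superalgebra.quotient (maxIdeal p R) (isIdeal_maxIdeal p R)

instance : IsLieSuperalgebra (G p R) :=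
  Superalgebra.isLie_quotient (maxIdeal p R) (isIdeal_maxIdeal p R)

/-- The image in `g(A)` of an element of `g̃(A)`. -/
def G.mk : GTilde p R →ₗ[ℂ] G p R := (maxIdeal p R).mkQ

/-- The generators `Xᵢ` of `g(A)`. -/
def G.X (i : ι) : G p R := G.mk p R (GTilde.mk p R (Free.gen p H (.X i)))

/-- The generators `Yᵢ` of `g(A)`. -/
def G.Y (i : ι) : G p R := G.mk p R (GTilde.mk p R (Free.gen p H (.Y i)))

/-- The canonical linear map from `H` to `g(A)`. -/
def G.cartan : H →ₗ[ℂ] G p R := G.mk p R ∘ₗ GTilde.cartan p R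

/-- The weight space `g_μ = {x | [h, x] = μ(h) x for all h ∈ H}` of `μ ∈ H*`. -/
def rootSpace (μ : Module.Dual ℂ H) : Submodule ℂ (G p R) where
  carrier := {x | ∀ v : H, bracket (G.cartan p R v) x = μ v • x}
  add_mem' hx hy v := by rw [map_add, hx v, hy v, smul_add]
  zero_mem' v := by simp
  smul_mem' c x hx v := by rw [map_smul, hx v, smul_comm]

/-- The component of degree `m` of the principal grading: the sum of the weight spaces of the
weights `∑ cᵢ αᵢ`, with integers `cᵢ`, of height `∑ cᵢ = m`. -/
def principalPart (m : ℤ) : Submodule ℂ (G p R) :=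
  ⨆ (c : ι → ℤ) (_ : ∑ i, c i = m), rootSpace p R (∑ i, c i • R.root i)

/-- `g(A)` has finite growth: `dim g_m` is bounded by a polynomial in `|m|`. -/
def FiniteGrowth : Prop :=
  ∃ C d : ℕ, ∀ m : ℤ,
    Module.rank ℂ (principalPart p R m) ≤ ((C * (m.natAbs + 1) ^ d : ℕ) : Cardinal)

/-- `g(A)` is integrable: every `ad Xᵢ` is locally nilpotent. -/
def Integrable : Prop :=
  ∀ (i : ι) (x : G p R), ∃ k : ℕ, (fun y => bracket (G.X p R i) y)^[k] x = 0

end Construction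

end Contragredient

end

noncomputable section

/-! The adjoint operator of an even element is a derivation, so the vectors on which it is nilpotent
form a subalgebra; an odd `Xᵢ` may be replaced by `[Xᵢ, Xᵢ]`. Only generators need testing, and the
only ones in doubt are the `Xⱼ` with `j ≠ i`. The task is to show that the string `(ad Xᵢ)ⁿ Xⱼ`
stops (`FiniteGrowth.exists_string_eq_zero`).

Suppose that it does not. Then `aᵢⱼ`, `aⱼᵢ` are not both zero, and `Xᵢ` is not odd with `aᵢᵢ = 0`,
since then `[Xᵢ, Xᵢ] = 0`. There is thus an even triple `X, Y, h` with `h = hᵢ`: the generators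
themselves, or multiples of their squares when `i` is odd. Put `e = Xⱼ`, `f = Yⱼ`, `eₙ = (ad X)ⁿ e`,
`fₙ = (ad Y)ⁿ f`. The bracket `[fₘ, eₙ]` is zero when `m` and `n` differ by at least two, and `[fₙ,
eₙ]` for `n ≥ 1` is an explicit Cartan element with a nonzero factor, because the string is infinite
(`Ladder.down_up_eq_zero`, `Ladder.down_up_self`). For increasing exponents with gaps at least two,
applying the corresponding `f`'s to `e_{g (s-1)} ⋯ e_{g 0} v` strips the letters off one by one, so
such words are linearly independent as soon as the Cartan elements act by nonzero scalars
(`Ladder.linearIndependent_word`). With `B` choices for each of `s` letters there are `Bˢ` words in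
degrees linear in `B`; a large `s` contradicts polynomial growth (`not_finiteGrowth_of_ladder`).

A suitable `v` is a far member of the string, or, if `aⱼᵢ = aⱼⱼ = 0`, a generator `Xₘ` with `aⱼₘ ≠
0`; this is where the absence of zero rows enters (`not_finiteGrowth_of_triple`).

Vanishing in `g(A)` is detected by `G.eq_zero_of_bracket_Y`: a homogeneous weight vector of positive
degree killed by all `Yⱼ` generates an ideal avoiding the Cartan subalgebra. This needs `H` to embed
in `g(A)`, which follows from Verma modules for `g̃(A)` and the triangular decomposition. -/

theorem superSign_zero_left (b : ZMod 2) : superSign 0 b = 1 := by simp [superSign]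

theorem superSign_zero_right (a : ZMod 2) : superSign a 0 = 1 := by simp [superSign]

theorem superSign_one_one : superSign 1 1 = -1 := by
  have : ((1 : ZMod 2) * 1).val = 1 := rfl
  rw [superSign, this, pow_one]

theorem superSign_ne_zero (a b : ZMod 2) : superSign a b ≠ 0 :=
  pow_ne_zero _ (by norm_num)

/-! ### Brackets between the two strings of a ladder -/

namespace Superalgebra

variable {L : Type*} [AddCommGroup L] [Module ℂ L] [Superalgebra L]

theorem exists_add_eq (x : L) :
    ∃ y ∈ part (L := L) 0, ∃ z ∈ part (L := L) 1, y + z = x := by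
  have ht : x ∈ part (L := L) 0 ⊔ part 1 := by
    rw [(isCompl (L := L)).sup_eq_top]; trivial
  exact Submodule.mem_sup.mp ht

/-- Elements which behave like the Chevalley generators attached to an even simple root and to
another simple root: `X`, `Y`, `h` are the generators of the even root, `e`, `f` are those of the
other root and `k = [f, e]`. -/
structure Ladder (L : Type*) [AddCommGroup L] [Module ℂ L] [Superalgebra L]
    (a b c : ℂ) (q : ZMod 2) where
  (X Y h e f k : L)
  X_mem : X ∈ part (L := L) 0
  Y_mem : Y ∈ part (L := L) 0
  e_mem : e ∈ part (L := L) q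
  f_mem : f ∈ part (L := L) q
  X_Y : bracket X Y = h
  f_e : bracket f e = k
  Y_e : bracket Y e = 0
  X_f : bracket X f = 0
  h_X : bracket h X = c • X
  h_Y : bracket h Y = -c • Y
  h_e : bracket h e = a • e
  h_f : bracket h f = -a • f
  k_X : bracket k X = b • X
  k_Y : bracket k Y = -b • Y

namespace Ladder

variable {a b c : ℂ} {q : ZMod 2} (S : Ladder L a b c q)

/-- The string `(ad X)ⁿ e`. -/
def up (n : ℕ) : L := (bracket S.X)^[n] S.e

/-- The string `(ad Y)ⁿ f`. -/
def down (n : ℕ) : L := (bracket S.Y)^[n] S.f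

theorem up_zero : S.up 0 = S.e := rfl

theorem down_zero : S.down 0 = S.f := rfl

theorem up_succ (n : ℕ) : S.up (n + 1) = bracket S.X (S.up n) :=
  Function.iterate_succ_apply' _ _ _

theorem down_succ (n : ℕ) : S.down (n + 1) = bracket S.Y (S.down n) :=
  Function.iterate_succ_apply' _ _ _

theorem up_mem (n : ℕ) : S.up n ∈ part (L := L) q := by
  induction n with
  | zero => exact S.e_mem
  | succ n ih =>
    rw [up_succ]
    simpa using bracket_mem 0 q _ _ S.X_mem ih

theorem down_mem (n : ℕ) : S.down n ∈ part (L := L) q := by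
  induction n with
  | zero => exact S.f_mem
  | succ n ih =>
    rw [down_succ]
    simpa using bracket_mem 0 q _ _ S.Y_mem ih

theorem h_mem : S.h ∈ part (L := L) 0 := by
  rw [← S.X_Y]
  simpa using bracket_mem 0 0 _ _ S.X_mem S.Y_mem

end Ladder

variable [IsLieSuperalgebra L]

theorem jacobi_even {x : L} (hx : x ∈ part (L := L) 0) (y z : L) :
    bracket x (bracket y z) = bracket (bracket x y) z + bracket y (bracket x z) := by
  obtain ⟨y0, h0, y1, h1, rfl⟩ := exists_add_eq y
  have e0 := IsLieSuperalgebra.jacobi 0 0 x y0 z hx h0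
  have e1 := IsLieSuperalgebra.jacobi 0 1 x y1 z hx h1
  rw [superSign_zero_left, one_smul] at e0 e1
  simp only [map_add, LinearMap.add_apply, e0, e1]
  abel

theorem jacobi_even' {y : L} (hy : y ∈ part (L := L) 0) (x z : L) :
    bracket x (bracket y z) = bracket (bracket x y) z + bracket y (bracket x z) := by
  obtain ⟨x0, h0, x1, h1, rfl⟩ := exists_add_eq x
  have e0 := IsLieSuperalgebra.jacobi 0 0 x0 y z h0 hy
  have e1 := IsLieSuperalgebra.jacobi 1 0 x1 y z h1 hy
  rw [superSign_zero_right, one_smul] at e0 e1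
  simp only [map_add, LinearMap.add_apply, e0, e1]
  abel

theorem skew_even {x : L} (hx : x ∈ part (L := L) 0) (y : L) :
    bracket x y = -bracket y x := by
  obtain ⟨y0, h0, y1, h1, rfl⟩ := exists_add_eq y
  have e0 := IsLieSuperalgebra.skew 0 0 x y0 hx h0
  have e1 := IsLieSuperalgebra.skew 0 1 x y1 hx h1
  rw [superSign_zero_left, one_smul] at e0 e1
  simp only [map_add, LinearMap.add_apply, e0, e1]
  abel

theorem bracket_self_even {x : L} (hx : x ∈ part (L := L) 0) : bracket x x = 0 := by
  have h := skew_even hx x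
  rw [eq_neg_iff_add_eq_zero, ← two_smul ℂ] at h
  exact (smul_eq_zero.mp h).resolve_left two_ne_zero

namespace Ladder

variable {a b c : ℂ} {q : ZMod 2} (S : Ladder L a b c q)

theorem Y_X : bracket S.Y S.X = -S.h := by
  rw [skew_even S.Y_mem, S.X_Y]

theorem h_up (n : ℕ) : bracket S.h (S.up n) = (a + n * c) • S.up n := by
  induction n with
  | zero => simp [up_zero, S.h_e]
  | succ n ih =>
    rw [up_succ, jacobi_even S.h_mem, S.h_X, ih, map_smul, map_smul, LinearMap.smul_apply]
    push_cast
    module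

theorem h_down (n : ℕ) : bracket S.h (S.down n) = -(a + n * c) • S.down n := by
  induction n with
  | zero => simp [down_zero, S.h_f]
  | succ n ih =>
    rw [down_succ, jacobi_even S.h_mem, S.h_Y, ih, map_smul, map_smul, LinearMap.smul_apply]
    push_cast
    module

/-- The coefficient in `[Y, (ad X)ⁿ⁺¹ e] = -dₙ (ad X)ⁿ e`. -/
def coeff (a c : ℂ) (n : ℕ) : ℂ := (n + 1) * (a + n * c / 2)

/-- The increment is the eigenvalue of `h` on `up (n + 1)`; this is what each commutation of `Y`
past `X` contributes in `Y_up`. -/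
theorem coeff_succ (n : ℕ) : coeff a c (n + 1) = coeff a c n + (a + (n + 1 : ℕ) * c) := by
  simp only [coeff]
  push_cast
  ring

theorem Y_up (n : ℕ) : bracket S.Y (S.up (n + 1)) = -coeff a c n • S.up n := by
  induction n with
  | zero =>
    rw [up_succ, jacobi_even S.Y_mem, S.Y_X, up_zero, S.Y_e, map_neg, LinearMap.neg_apply, S.h_e]
    simp [coeff]
  | succ n ih =>
    rw [up_succ, jacobi_even S.Y_mem, S.Y_X, ih, map_neg, LinearMap.neg_apply, h_up, map_smul,
      ← up_succ, coeff_succ]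
    module

theorem X_down (n : ℕ) : bracket S.X (S.down (n + 1)) = -coeff a c n • S.down n := by
  induction n with
  | zero =>
    rw [down_succ, jacobi_even S.X_mem, S.X_Y, down_zero, S.X_f, S.h_f]
    simp [coeff]
  | succ n ih =>
    rw [down_succ, jacobi_even S.X_mem, S.X_Y, ih, h_down, map_smul, ← down_succ, coeff_succ]
    module

/-- Obtained by peeling `X` off the raising string; `down_up_succ_left` peels `Y` off the lowering
one. These recursions reduce all brackets of the two strings to `[f, e] = k`. -/
theorem down_up_succ_right (m n : ℕ) : bracket (S.down (m + 1)) (S.up (n + 1)) =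
    coeff a c m • bracket (S.down m) (S.up n) +
      bracket S.X (bracket (S.down (m + 1)) (S.up n)) := by
  rw [up_succ, jacobi_even' S.X_mem, ← neg_neg (bracket (S.down (m + 1)) S.X),
    ← skew_even S.X_mem, X_down, neg_smul, neg_neg, map_smul, LinearMap.smul_apply]

theorem down_up_succ_left (m n : ℕ) : bracket (S.down (m + 1)) (S.up (n + 1)) =
    coeff a c n • bracket (S.down m) (S.up n) +
      bracket S.Y (bracket (S.down m) (S.up (n + 1))) := by
  have h := jacobi_even S.Y_mem (S.down m) (S.up (n + 1))
  rw [← down_succ, Y_up, map_smul] at h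
  rw [h]
  module

theorem down_zero_up (n : ℕ) :
    bracket (S.down 0) (S.up (n + 1)) = bracket S.X (bracket (S.down 0) (S.up n)) := by
  rw [up_succ, jacobi_even' S.X_mem, down_zero, ← neg_neg (bracket S.f S.X),
    ← skew_even S.X_mem, S.X_f]
  simp

theorem down_up_zero (n : ℕ) :
    bracket (S.down (n + 1)) (S.up 0) = bracket S.Y (bracket (S.down n) (S.up 0)) := by
  have h := jacobi_even S.Y_mem (S.down n) (S.up 0)
  rw [← down_succ, up_zero, S.Y_e, map_zero, add_zero] at h
  exact h.symm

/-- The product `d₁ ⋯ dₙ`. -/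
def norm (a c : ℂ) (n : ℕ) : ℂ := ∏ i ∈ Finset.range n, coeff a c (i + 1)

/-- The two brackets need a joint induction: the next off-diagonal one comes from both previous ones
by peeling `X`, the next diagonal one then by peeling `Y`. The factor `d₀ = a` is kept out of
`norm`, so no division is needed when `a = 0`. -/
theorem down_up_aux (n : ℕ) :
    bracket (S.down n) (S.up (n + 1)) = -(b * norm a c n) • S.X ∧
      bracket (S.down (n + 1)) (S.up (n + 1)) =
        norm a c n • (a • S.k + ((n + 1 : ℕ) * b) • S.h) := by
  have key : bracket (a • S.k) S.X = (a * b) • S.X := by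
    rw [map_smul, LinearMap.smul_apply, S.k_X, smul_smul]
  induction n with
  | zero =>
    have h0 : bracket (S.down 0) (S.up 1) = -b • S.X := by
      rw [down_zero_up, down_zero, up_zero, S.f_e, skew_even S.X_mem, S.k_X, neg_smul]
    constructor
    · simpa [norm] using h0
    · rw [down_up_succ_left, h0, down_zero, up_zero, S.f_e, map_smul, Y_X]
      simp [norm, coeff]
  | succ n ih =>
    have h0 : bracket (S.down (n + 1)) (S.up (n + 2)) = -(b * norm a c (n + 1)) • S.X := by
      rw [down_up_succ_right, ih.1, ih.2, skew_even S.X_mem]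
      simp only [map_add, map_smul, LinearMap.add_apply, LinearMap.smul_apply, S.k_X, S.h_X,
        norm, Finset.prod_range_succ, coeff]
      push_cast
      module
    refine ⟨h0, ?_⟩
    rw [down_up_succ_left, h0, ih.2, map_smul, Y_X]
    simp only [norm, Finset.prod_range_succ]
    push_cast
    module

theorem down_up_self (n : ℕ) : bracket (S.down (n + 1)) (S.up (n + 1)) =
    norm a c n • (a • S.k + ((n + 1 : ℕ) * b) • S.h) :=
  (S.down_up_aux n).2

/-- One step off the diagonal the bracket is a multiple of `X`; a second step applies `ad X`, and
`[X, X] = 0` because `X` is even. The recursion propagates the vanishing. -/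
theorem down_up_add_two (m n : ℕ) : bracket (S.down m) (S.up (m + n + 2)) = 0 := by
  induction m generalizing n with
  | zero =>
    induction n with
    | zero =>
      rw [down_zero_up, (S.down_up_aux 0).1, map_smul, bracket_self_even S.X_mem, smul_zero]
    | succ n ih =>
      rw [← add_assoc, show 0 + n + 1 + 2 = 0 + n + 2 + 1 by ring, down_zero_up, ih, map_zero]
  | succ m ih =>
    have h2 : ∀ n, bracket (S.down m) (S.up (m + n + 2)) = 0 := ih
    induction n with
    | zero =>
      rw [show m + 1 + 0 + 2 = m + 2 + 1 by ring, down_up_succ_right, ih 0,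
        (S.down_up_aux (m + 1)).1, map_smul, bracket_self_even S.X_mem]
      simp
    | succ n ih' =>
      rw [show m + 1 + (n + 1) + 2 = m + n + 3 + 1 by ring, down_up_succ_right,
        show m + n + 3 = m + (n + 1) + 2 by ring, h2,
        show m + (n + 1) + 2 = m + 1 + n + 2 by ring, ih']
      simp

theorem down_succ_up (n : ℕ) : ∃ z : ℂ, bracket (S.down (n + 1)) (S.up n) = z • S.Y := by
  induction n with
  | zero =>
    rw [down_up_zero, down_zero, up_zero, S.f_e, skew_even S.Y_mem, S.k_Y]
    exact ⟨b, by simp⟩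
  | succ n ih =>
    obtain ⟨z, hz⟩ := ih
    rw [down_up_succ_left, hz, down_up_self, skew_even S.Y_mem]
    simp only [map_add, map_smul, LinearMap.add_apply, LinearMap.smul_apply, S.k_Y, S.h_Y]
    exact ⟨coeff a c n * z + norm a c n * (a * b + ((n + 1 : ℕ) * b) * c), by module⟩

theorem down_add_two_up (m n : ℕ) : bracket (S.down (m + n + 2)) (S.up m) = 0 := by
  induction m generalizing n with
  | zero =>
    induction n with
    | zero =>
      obtain ⟨z, hz⟩ := S.down_succ_up 0
      rw [down_up_zero, hz, map_smul, bracket_self_even S.Y_mem, smul_zero]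
    | succ n ih =>
      rw [← add_assoc, show 0 + n + 1 + 2 = 0 + n + 2 + 1 by ring, down_up_zero, ih, map_zero]
  | succ m ih =>
    have h2 : ∀ n, bracket (S.down (m + n + 2)) (S.up m) = 0 := ih
    induction n with
    | zero =>
      obtain ⟨z, hz⟩ := S.down_succ_up (m + 1)
      rw [show m + 1 + 0 + 2 = m + 2 + 1 by ring, down_up_succ_left, ih 0,
        hz, map_smul, bracket_self_even S.Y_mem]
      simp
    | succ n ih' =>
      rw [show m + 1 + (n + 1) + 2 = m + n + 3 + 1 by ring, down_up_succ_left,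
        show m + n + 3 = m + (n + 1) + 2 by ring, h2,
        show m + (n + 1) + 2 = m + 1 + n + 2 by ring, ih']
      simp

theorem down_up_eq_zero {m n : ℕ} (h : m + 2 ≤ n ∨ n + 2 ≤ m) :
    bracket (S.down m) (S.up n) = 0 := by
  rcases h with h | h
  · obtain ⟨k, rfl⟩ := Nat.exists_eq_add_of_le h
    rw [add_right_comm]
    exact S.down_up_add_two m k
  · obtain ⟨k, rfl⟩ := Nat.exists_eq_add_of_le h
    rw [add_right_comm]
    exact S.down_add_two_up n k

end Ladder

end Superalgebra

/-! ### Linear independence of words in the raising string -/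

namespace Superalgebra

namespace Ladder

variable {L : Type*} [AddCommGroup L] [Module ℂ L] [Superalgebra L]
  {a b c : ℂ} {q : ZMod 2} (S : Ladder L a b c q)

/-- The iterated bracket `[e_{g (r-1)}, [..., [e_{g 0}, v]]]`, where `eₙ = (ad X)ⁿ e`. -/
def word (v : L) (g : ℕ → ℕ) : ℕ → L
  | 0 => v
  | r + 1 => bracket (S.up (g r)) (word v g r)

/-- The operator `ad f_{g 0} ∘ ... ∘ ad f_{g (r-1)}`, where `fₙ = (ad Y)ⁿ f`. -/
def unword (g : ℕ → ℕ) : ℕ → L →ₗ[ℂ] L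
  | 0 => LinearMap.id
  | r + 1 => unword g r ∘ₗ bracket (S.down (g r))

variable [IsLieSuperalgebra L]

theorem down_word {v : L} {g : ℕ → ℕ} {l r : ℕ} (hv : bracket (S.down l) v = 0)
    (hg : ∀ i < r, g i + 2 ≤ l) : bracket (S.down l) (S.word v g r) = 0 := by
  induction r with
  | zero => exact hv
  | succ r ih =>
    rw [word, IsLieSuperalgebra.jacobi q q _ _ _ (S.down_mem l) (S.up_mem (g r)),
      ih fun i hi => hg i (by omega), S.down_up_eq_zero (Or.inr (hg r (by omega)))]
    simp

/-- By the Jacobi identity the outermost `f` either meets the letter with its own exponent, giving a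
nonzero scalar, or passes inwards, where the remaining exponents are smaller by at least two and `v`
is killed. -/
theorem unword_word_of_eq {v : L} {g : ℕ → ℕ} {s : ℕ}
    (hsep : ∀ i j, i < j → j < s → g i + 2 ≤ g j)
    (hv : ∀ i < s, bracket (S.down (g i)) v = 0)
    (hz : ∀ i < s, ∃ z : ℂ, z ≠ 0 ∧
      bracket (bracket (S.down (g i)) (S.up (g i))) (S.word v g i) = z • S.word v g i)
    {r : ℕ} (hr : r ≤ s) : ∃ z : ℂ, z ≠ 0 ∧ S.unword g r (S.word v g r) = z • v := by
  induction r with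
  | zero => exact ⟨1, one_ne_zero, by simp [unword, word]⟩
  | succ r ih =>
    obtain ⟨z, hz0, hz1⟩ := ih (by omega)
    obtain ⟨w, hw0, hw1⟩ := hz r hr
    refine ⟨w * z, mul_ne_zero hw0 hz0, ?_⟩
    rw [unword, word, LinearMap.comp_apply,
      IsLieSuperalgebra.jacobi q q _ _ _ (S.down_mem (g r)) (S.up_mem (g r)),
      S.down_word (hv r hr) fun i hi => hsep i r hi hr, hw1, map_zero, smul_zero, add_zero,
      map_smul, hz1, smul_smul]

/-- Letters are stripped from the outside as long as the exponents agree; at the outermost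
disagreement they differ by at least two, so the bracket of `f` with the letter vanishes. -/
theorem unword_word_of_ne {v : L} {g g' : ℕ → ℕ} {s : ℕ}
    (hsep : ∀ i j, i < j → j < s → g' i + 2 ≤ g j)
    (hne : ∀ i < s, g i = g' i ∨ g i + 2 ≤ g' i ∨ g' i + 2 ≤ g i)
    (hv : ∀ i < s, bracket (S.down (g i)) v = 0)
    (hz : ∀ i < s, ∃ z : ℂ,
      bracket (bracket (S.down (g' i)) (S.up (g' i))) (S.word v g' i) = z • S.word v g' i)
    {r : ℕ} (hr : r ≤ s) (h : ∃ i < r, g i ≠ g' i) : S.unword g r (S.word v g' r) = 0 := by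
  induction r with
  | zero => simp at h
  | succ r ih =>
    rw [unword, word, LinearMap.comp_apply,
      IsLieSuperalgebra.jacobi q q _ _ _ (S.down_mem (g r)) (S.up_mem (g' r)),
      S.down_word (hv r hr) fun i hi => hsep i r hi hr, map_zero, smul_zero, add_zero]
    rcases hne r hr with e | e
    · have h' : ∃ i < r, g i ≠ g' i := by
        obtain ⟨i, hi, hi'⟩ := h
        refine ⟨i, lt_of_le_of_ne (by omega) ?_, hi'⟩
        rintro rfl
        exact hi' e
      obtain ⟨w, hw⟩ := hz r hr
      rw [e, hw, map_smul, ih (by omega) h', smul_zero]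
    · rw [S.down_up_eq_zero e]
      simp

/-- Exponents from `s` consecutive blocks, each consisting of `B` numbers which differ by at
least `2`. -/
def blockExponent (K B : ℕ) {s : ℕ} (φ : Fin s → Fin B) (r : ℕ) : ℕ :=
  K + 2 * (r * B + if h : r < s then (φ ⟨r, h⟩ : ℕ) else 0)

theorem blockExponent_sep (K B : ℕ) {s : ℕ} (φ ψ : Fin s → Fin B) {i j : ℕ} (hij : i < j)
    (hj : j < s) : blockExponent K B φ i + 2 ≤ blockExponent K B ψ j := by
  have h1 := (φ ⟨i, hij.trans hj⟩).2
  have h2 : (i + 1) * B ≤ j * B := Nat.mul_le_mul_right _ hij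
  rw [add_mul] at h2
  simp only [blockExponent, hj, hij.trans hj, dif_pos]
  omega

theorem blockExponent_le (K B : ℕ) {s : ℕ} (φ : Fin s → Fin B) {i : ℕ} (hi : i < s) :
    blockExponent K B φ i ≤ K + 2 * (s * B) := by
  have h1 := (φ ⟨i, hi⟩).2
  have h2 : (i + 1) * B ≤ s * B := Nat.mul_le_mul_right _ hi
  rw [add_mul] at h2
  simp only [blockExponent, hi, dif_pos]
  omega

theorem le_blockExponent (K B : ℕ) {s : ℕ} (φ : Fin s → Fin B) (i : ℕ) :
    K ≤ blockExponent K B φ i :=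
  Nat.le_add_right _ _

/-- The operators `unword` act as a dual system: the one belonging to `φ` sends its own word to a
nonzero multiple of `v` and all the others to zero. -/
theorem linearIndependent_word {v : L} (hv0 : v ≠ 0) {K B s : ℕ}
    (hv : ∀ k, K ≤ k → bracket (S.down k) v = 0)
    (hz : ∀ φ : Fin s → Fin B, ∀ i < s, ∃ z : ℂ, z ≠ 0 ∧
      bracket (bracket (S.down (blockExponent K B φ i)) (S.up (blockExponent K B φ i)))
        (S.word v (blockExponent K B φ) i) = z • S.word v (blockExponent K B φ) i) :
    LinearIndependent ℂ fun φ : Fin s → Fin B => S.word v (blockExponent K B φ) s := by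
  rw [linearIndependent_iff']
  intro t w hw φ hφ
  have h := congrArg (S.unword (blockExponent K B φ) s) hw
  rw [map_sum, map_zero, Finset.sum_eq_single_of_mem φ hφ, map_smul] at h
  · obtain ⟨z, hz0, hz1⟩ := S.unword_word_of_eq (s := s)
      (fun i j hij hj => blockExponent_sep K B φ φ hij hj)
      (fun i _ => hv _ (le_blockExponent K B φ i)) (hz φ) le_rfl
    rw [hz1, smul_smul] at h
    have h' := (smul_eq_zero.mp h).resolve_right hv0
    exact (mul_eq_zero.mp h').resolve_right hz0
  · intro ψ _ hψ
    rw [map_smul, S.unword_word_of_ne (s := s)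
      (fun i j hij hj => blockExponent_sep K B ψ φ hij hj) ?_
      (fun i _ => hv _ (le_blockExponent K B φ i))
      (fun i hi => (hz ψ i hi).imp fun _ h => h.2) le_rfl ?_, smul_zero]
    · intro i hi
      simp only [blockExponent, hi, dif_pos]
      omega
    · obtain ⟨i, hi⟩ := Function.ne_iff.mp hψ
      refine ⟨i, i.2, fun e => hi (Fin.ext ?_)⟩
      simp only [blockExponent, i.2, dif_pos] at e
      simp only [Fin.eta] at e
      omega

end Ladder

end Superalgebra

/-! ### Signs and the supercommutator on an associative algebra with involution -/

theorem zmod_two_cases (a : ZMod 2) : a = 0 ∨ a = 1 := by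
  revert a
  decide

theorem superSign_comm (a b : ZMod 2) : superSign a b = superSign b a := by
  rw [superSign, superSign, mul_comm]

theorem superSign_mul_self (a b : ZMod 2) : superSign a b * superSign a b = 1 := by
  rw [superSign, ← pow_add, ← two_mul, pow_mul]
  norm_num

theorem superSign_add_right (a b c : ZMod 2) :
    superSign a (b + c) = superSign a b * superSign a c := by
  rw [superSign, superSign, superSign, ← pow_add, mul_add,
    Contragredient.neg_one_pow_val_add]

theorem superSign_add_left (a b c : ZMod 2) :
    superSign (a + b) c = superSign a c * superSign b c := by
  rw [superSign_comm, superSign_add_right, superSign_comm c a, superSign_comm c b]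

/-- The associative algebra `E`, graded by the conjugation with an involution `σ`, and considered
with the supercommutator as its product. -/
def SuperCommutator (E : Type*) [Ring E] [Algebra ℂ E] (_σ : E) : Type _ := E

namespace SuperCommutator

variable {E : Type*} [Ring E] [Algebra ℂ E] (σ : E)

instance : AddCommGroup (SuperCommutator E σ) := inferInstanceAs (AddCommGroup E)

instance : Module ℂ (SuperCommutator E σ) := inferInstanceAs (Module ℂ E)

/-- The supercommutator with respect to `σ`. -/
def comm (x y : E) : E :=
  x * y - (2⁻¹ : ℂ) • (y * (x + σ * x * σ)) - (2⁻¹ : ℂ) • (σ * y * σ * (x - σ * x * σ))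

theorem comm_add_right (x y z : E) : comm σ x (y + z) = comm σ x y + comm σ x z := by
  simp only [comm, mul_add, add_mul, mul_sub, smul_add, smul_sub]
  abel

theorem comm_add_left (x y z : E) : comm σ (x + y) z = comm σ x z + comm σ y z := by
  simp only [comm, mul_add, add_mul, mul_sub, smul_add, smul_sub]
  abel

theorem comm_smul_right (c : ℂ) (x y : E) : comm σ x (c • y) = c • comm σ x y := by
  simp only [comm, mul_add, mul_sub, smul_add, smul_sub, smul_mul_assoc, mul_smul_comm,
    smul_comm c (2⁻¹ : ℂ)]

theorem comm_smul_left (c : ℂ) (x y : E) : comm σ (c • x) y = c • comm σ x y := by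
  simp only [comm, mul_add, mul_sub, smul_add, smul_sub, smul_mul_assoc, mul_smul_comm,
    smul_comm c (2⁻¹ : ℂ)]

instance : Mul (SuperCommutator E σ) := ⟨comm (E := E) σ⟩

instance : NonUnitalNonAssocRing (SuperCommutator E σ) where
  left_distrib := comm_add_right (E := E) σ
  right_distrib := comm_add_left (E := E) σ
  zero_mul x := by
    have h := comm_smul_left (E := E) σ 0 0 x
    rw [zero_smul, zero_smul] at h
    exact h
  mul_zero x := by
    have h := comm_smul_right (E := E) σ 0 x 0
    rw [zero_smul, zero_smul] at h
    exact h

instance : IsScalarTower ℂ (SuperCommutator E σ) (SuperCommutator E σ) :=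
  ⟨comm_smul_left (E := E) σ⟩

instance : SMulCommClass ℂ (SuperCommutator E σ) (SuperCommutator E σ) :=
  ⟨fun c x y => (comm_smul_right (E := E) σ c x y).symm⟩

/-- The elements of parity `a`. -/
def IsHom (a : ZMod 2) (x : E) : Prop := σ * x = ((-1 : ℂ) ^ a.val) • (x * σ)

variable {σ}

theorem IsHom.zero_iff {x : E} : IsHom σ 0 x ↔ σ * x = x * σ := by
  simp [IsHom]

theorem IsHom.one_iff {x : E} : IsHom σ 1 x ↔ σ * x = -(x * σ) := by
  have : (1 : ZMod 2).val = 1 := rfl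
  simp [IsHom, this]

theorem IsHom.mul {a b : ZMod 2} {x y : E} (hx : IsHom σ a x) (hy : IsHom σ b y) :
    IsHom σ (a + b) (x * y) := by
  unfold IsHom at *
  rw [← mul_assoc, hx, smul_mul_assoc, mul_assoc, hy, mul_smul_comm, smul_smul, ← pow_add,
    Contragredient.neg_one_pow_val_add, mul_assoc]

theorem IsHom.smul {a : ZMod 2} {x : E} (c : ℂ) (hx : IsHom σ a x) : IsHom σ a (c • x) := by
  unfold IsHom at *
  rw [mul_smul_comm, hx, smul_mul_assoc, smul_comm]

theorem IsHom.add {a : ZMod 2} {x y : E} (hx : IsHom σ a x) (hy : IsHom σ a y) :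
    IsHom σ a (x + y) := by
  unfold IsHom at *
  rw [mul_add, hx, hy, add_mul, smul_add]

theorem IsHom.zero (a : ZMod 2) : IsHom σ a 0 := by simp [IsHom]

theorem IsHom.sub {a : ZMod 2} {x y : E} (hx : IsHom σ a x) (hy : IsHom σ a y) :
    IsHom σ a (x - y) := by
  unfold IsHom at *
  rw [mul_sub, hx, hy, sub_mul, smul_sub]

theorem IsHom.eq_zero_of_add_eq_zero (hσ : σ * σ = 1) {x y : E} (hx : IsHom σ 0 x)
    (hy : IsHom σ 1 y) (h : x + y = 0) : x = 0 ∧ y = 0 := by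
  have hx' := IsHom.zero_iff.mp hx
  have hy' := IsHom.one_iff.mp hy
  have e : x = -y := eq_neg_of_add_eq_zero_left h
  rw [e, mul_neg, hy', neg_neg, neg_mul, eq_neg_iff_add_eq_zero, ← two_smul ℂ] at hx'
  have h5 := (smul_eq_zero.mp hx').resolve_left two_ne_zero
  have h6 : y = 0 := by rw [← mul_one y, ← hσ, ← mul_assoc, h5, zero_mul]
  exact ⟨by rw [e, h6, neg_zero], h6⟩

theorem comm_zero_left (x : E) : comm σ 0 x = 0 := by simp [comm]

theorem comm_zero_right (x : E) : comm σ x 0 = 0 := by simp [comm]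

/-- Half of `x ± σ x σ` is the even or odd part of `x`, and conjugating `y` by `σ` supplies the sign
for odd `x`. So the bilinear `comm`, defined on all of `E`, is the usual supercommutator on
homogeneous elements. -/
theorem comm_of_isHom (hσ : σ * σ = 1) {a b : ZMod 2} {x y : E} (hx : IsHom σ a x)
    (hy : IsHom σ b y) : comm σ x y = x * y - superSign a b • (y * x) := by
  have hh : ∀ z : E, (2⁻¹ : ℂ) • (z + z) = z := fun z => by
    rw [← two_smul ℂ z, smul_smul]
    norm_num
  have hz : ∀ {z : E}, IsHom σ 0 z → σ * z * σ = z := fun h => by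
    rw [IsHom.zero_iff.mp h, mul_assoc, hσ, mul_one]
  have ho : ∀ {z : E}, IsHom σ 1 z → σ * z * σ = -z := fun h => by
    rw [IsHom.one_iff.mp h, neg_mul, mul_assoc, hσ, mul_one]
  rcases zmod_two_cases a with rfl | rfl <;> rcases zmod_two_cases b with rfl | rfl
  · rw [comm, hz hx, hz hy, mul_add, hh, superSign_zero_left]
    simp
  · rw [comm, hz hx, ho hy, mul_add, hh, superSign_zero_left]
    simp
  · rw [comm, ho hx, hz hy, superSign_zero_right, sub_neg_eq_add, mul_add y x x, hh]
    simp
  · rw [comm, ho hx, ho hy, superSign_one_one, sub_neg_eq_add, mul_add (-y) x x, hh]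
    simp

theorem IsHom.comm (hσ : σ * σ = 1) {a b : ZMod 2} {x y : E} (hx : IsHom σ a x)
    (hy : IsHom σ b y) : IsHom σ (a + b) (comm σ x y) := by
  rw [comm_of_isHom hσ hx hy]
  have h := hy.mul hx
  rw [add_comm b a] at h
  exact (hx.mul hy).sub (h.smul _)

theorem comm_skew (hσ : σ * σ = 1) {a b : ZMod 2} {x y : E} (hx : IsHom σ a x)
    (hy : IsHom σ b y) : comm σ x y + superSign a b • comm σ y x = 0 := by
  rw [comm_of_isHom hσ hx hy, comm_of_isHom hσ hy hx, superSign_comm b a, smul_sub, smul_smul,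
    superSign_mul_self, one_smul]
  abel

theorem comm_jacobi (hσ : σ * σ = 1) {a b c : ZMod 2} {x y z : E} (hx : IsHom σ a x)
    (hy : IsHom σ b y) (hz : IsHom σ c z) : comm σ x (comm σ y z) -
      (comm σ (comm σ x y) z + superSign a b • comm σ y (comm σ x z)) = 0 := by
  rw [comm_of_isHom hσ hx (hy.comm hσ hz), comm_of_isHom hσ (hx.comm hσ hy) hz,
    comm_of_isHom hσ hy (hx.comm hσ hz), comm_of_isHom hσ hx hy, comm_of_isHom hσ hx hz,
    comm_of_isHom hσ hy hz, superSign_add_right, superSign_add_right, superSign_add_left,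
    superSign_comm b a]
  -- The signs involving `c` may be arbitrary scalars; the identity only uses that the sign of `a,
  -- b` squares to one.
  have h := superSign_mul_self a b
  simp only [mul_sub, sub_mul, smul_sub, smul_smul, mul_smul_comm, smul_mul_assoc, mul_assoc]
  rcases mul_self_eq_one_iff.mp h with e | e <;> rw [e] <;> module

end SuperCommutator

/-! ### Verma modules and the embedding of `H` in `g̃(A)` -/

namespace Contragredient

open Superalgebra SuperCommutator

namespace Verma

variable {ι : Type*} (p : ι → ZMod 2)

/-- The underlying space of the Verma module: words in the lowering operators. -/
abbrev Space (ι : Type*) : Type _ := List ι →₀ ℂ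

/-- The parity of a word. -/
def wordParity : List ι → ZMod 2
  | [] => 0
  | j :: w => p j + wordParity w

/-- The parity operator. -/
def sigma : Module.End ℂ (Space ι) :=
  Finsupp.linearCombination ℂ fun w => Finsupp.single w ((-1 : ℂ) ^ (wordParity p w).val)

/-- The action of `Yⱼ`. -/
def opY (j : ι) : Module.End ℂ (Space ι) :=
  Finsupp.linearCombination ℂ fun w => Finsupp.single (j :: w) 1

@[simp]
theorem sigma_single (w : List ι) : sigma p (Finsupp.single w 1) =
    ((-1 : ℂ) ^ (wordParity p w).val) • Finsupp.single w 1 := by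
  simp [sigma]

@[simp]
theorem opY_single (j : ι) (w : List ι) :
    opY j (Finsupp.single w 1) = Finsupp.single (j :: w) 1 := by
  simp [opY]

theorem end_ext {S T : Module.End ℂ (Space ι)}
    (h : ∀ w, S (Finsupp.single w 1) = T (Finsupp.single w 1)) : S = T := by
  ext w
  simp [h w]

theorem sigma_mul_sigma : sigma p * sigma p = 1 := by
  refine end_ext fun w => ?_
  rw [Module.End.mul_apply, sigma_single, map_smul, sigma_single, smul_smul, ← pow_add, ← two_mul,
    pow_mul]
  simp

theorem isHom_opY (j : ι) : IsHom (sigma p) (p j) (opY j) := by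
  refine end_ext fun w => ?_
  rw [Module.End.mul_apply, opY_single, sigma_single, wordParity, LinearMap.smul_apply,
    Module.End.mul_apply, sigma_single, map_smul, smul_smul, opY_single, ← pow_add,
    neg_one_pow_val_add]

variable [Fintype ι] {A : Matrix ι ι ℂ} {H : Type*} [AddCommGroup H] [Module ℂ H]
  (R : Realization A H) (lam : Module.Dual ℂ H)

/-- The weight of a word. -/
def weight : List ι → Module.Dual ℂ H
  | [] => lam
  | j :: w => weight w - R.root j

/-- The action of `v ∈ H`. -/
def opH (v : H) : Module.End ℂ (Space ι) :=
  Finsupp.linearCombination ℂ fun w => Finsupp.single w (weight R lam w v)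

open Classical in
/-- The action of `Xᵢ` on words. -/
def raise (i : ι) : List ι → Space ι
  | [] => 0
  | j :: w => superSign (p i) (p j) • opY j (raise i w) +
      if i = j then Finsupp.single w (weight R lam w (R.coroot i)) else 0

/-- The action of `Xᵢ`. -/
def opX (i : ι) : Module.End ℂ (Space ι) := Finsupp.linearCombination ℂ (raise p R lam i)

@[simp]
theorem opH_single (v : H) (w : List ι) : opH R lam v (Finsupp.single w 1) =
    weight R lam w v • Finsupp.single w 1 := by
  simp [opH]

@[simp]
theorem opX_single (i : ι) (w : List ι) :
    opX p R lam i (Finsupp.single w 1) = raise p R lam i w := by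
  simp [opX]

theorem isHom_opH (v : H) : IsHom (sigma p) 0 (opH R lam v) := by
  rw [IsHom.zero_iff]
  refine end_ext fun w => ?_
  rw [Module.End.mul_apply, Module.End.mul_apply, opH_single, sigma_single, map_smul, map_smul,
    sigma_single, opH_single, smul_comm]

theorem sigma_raise (i : ι) (w : List ι) : sigma p (raise p R lam i w) =
    ((-1 : ℂ) ^ (p i + wordParity p w).val) • raise p R lam i w := by
  induction w with
  | nil => simp [raise]
  | cons j w ih =>
    have h := LinearMap.congr_fun (isHom_opY p j) (raise p R lam i w)
    rw [Module.End.mul_apply, LinearMap.smul_apply, Module.End.mul_apply, ih, map_smul,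
      smul_smul, ← pow_add, neg_one_pow_val_add] at h
    rw [raise, wordParity, map_add, map_smul, h, smul_add, smul_comm,
      show p j + (p i + wordParity p w) = p i + (p j + wordParity p w) by ring]
    congr 1
    split_ifs with e
    · subst e
      have h2 : p i + (p i + wordParity p w) = wordParity p w := by
        rw [← add_assoc, CharTwo.add_self_eq_zero, zero_add]
      rw [← mul_one (weight R lam w _), ← smul_eq_mul, ← Finsupp.smul_single, map_smul,
        sigma_single, h2, smul_comm]
    · simp

theorem isHom_opX (i : ι) : IsHom (sigma p) (p i) (opX p R lam i) := by
  refine end_ext fun w => ?_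
  rw [Module.End.mul_apply, opX_single, sigma_raise, LinearMap.smul_apply,
    Module.End.mul_apply, sigma_single, map_smul, smul_smul, opX_single, ← pow_add,
    neg_one_pow_val_add]

theorem opH_opY (v : H) (j : ι) :
    opH R lam v * opY j - opY j * opH R lam v = -R.root j v • opY j := by
  refine end_ext fun w => ?_
  simp only [Module.End.mul_apply, LinearMap.sub_apply, LinearMap.smul_apply, opY_single,
    opH_single, map_smul, weight]
  module

theorem opH_raise (v : H) (i : ι) (w : List ι) : opH R lam v (raise p R lam i w) =
    (weight R lam w v + R.root i v) • raise p R lam i w := by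
  induction w with
  | nil => simp [raise]
  | cons j w ih =>
    have h := LinearMap.congr_fun (opH_opY R lam v j) (raise p R lam i w)
    simp only [Module.End.mul_apply, LinearMap.sub_apply, LinearMap.smul_apply, ih,
      map_smul] at h
    rw [sub_eq_iff_eq_add] at h
    rw [raise, map_add, map_smul, h, weight, LinearMap.sub_apply, smul_add, smul_add]
    refine congr (congrArg HAdd.hAdd ?_) ?_
    · module
    · split_ifs with e
      · subst e
        rw [← mul_one (weight R lam w (R.coroot i)), ← smul_eq_mul, ← Finsupp.smul_single,
          map_smul, opH_single]
        module
      · simp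

/-- The action of the generators. -/
def op : Gen ι H → Module.End ℂ (Space ι)
  | .X i => opX p R lam i
  | .Y i => opY i
  | .h v => opH R lam v

theorem isHom_op (g : Gen ι H) : IsHom (sigma p) (g.parity p) (op p R lam g) := by
  cases g with
  | X i => exact isHom_opX p R lam i
  | Y i => exact isHom_opY p i
  | h v => exact isHom_opH p R lam v

/-- The action of the free algebra on the Verma module. -/
def rep : Free p H →ₙₐ[ℂ] SuperCommutator (Module.End ℂ (Space ι)) (sigma p) :=
  FreeNonUnitalNonAssocAlgebra.lift ℂ (op p R lam)

/-- The action of the free algebra on the Verma module, as a linear map. -/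
def repLin : Free p H →ₗ[ℂ] Module.End ℂ (Space ι) where
  toFun x := rep p R lam x
  map_add' x y := map_add (rep p R lam) x y
  map_smul' c x := map_smul (rep p R lam) c x

theorem repLin_gen (g : Gen ι H) : repLin p R lam (Free.gen p H g) = op p R lam g :=
  FreeNonUnitalNonAssocAlgebra.lift_of_apply
    (A := SuperCommutator (Module.End ℂ (Space ι)) (sigma p)) ℂ (op p R lam) g

theorem repLin_mul (x y : Free p H) :
    repLin p R lam (x * y) = comm (sigma p) (repLin p R lam x) (repLin p R lam y) :=
  map_mul (rep p R lam) x y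

theorem isHom_repLin {a : ZMod 2} {x : Free p H} (hx : x ∈ Free.part p H a) :
    IsHom (sigma p) a (repLin p R lam x) := by
  induction hx using Submodule.span_induction with
  | mem x hx =>
    induction hx with
    | gen g =>
      rw [repLin_gen]
      exact isHom_op p R lam g
    | mul _ _ ihx ihy =>
      rw [repLin_mul]
      exact ihx.comm (sigma_mul_sigma p) ihy
  | zero =>
    rw [map_zero]
    exact IsHom.zero a
  | add x y _ _ hx hy =>
    rw [map_add]
    exact hx.add hy
  | smul c x _ hx =>
    rw [map_smul]
    exact hx.smul c

theorem isIdeal_ker : IsIdeal (LinearMap.ker (repLin p R lam)) where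
  left x y hy := by
    change repLin p R lam (x * y) = 0
    rw [repLin_mul, LinearMap.mem_ker.mp hy]
    exact comm_zero_right _
  right x y hx := by
    change repLin p R lam (x * y) = 0
    rw [repLin_mul, LinearMap.mem_ker.mp hx]
    exact comm_zero_left _
  graded x hx := by
    obtain ⟨y, hy, z, hz, rfl⟩ := exists_add_eq x
    rw [LinearMap.mem_ker, map_add] at hx
    obtain ⟨h0, h1⟩ := IsHom.eq_zero_of_add_eq_zero (sigma_mul_sigma p) (isHom_repLin p R lam hy)
      (isHom_repLin p R lam hz) hx
    exact ⟨y, h0, z, h1, hy, hz, rfl⟩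

theorem repLin_gen_mul (g g' : Gen ι H) :
    repLin p R lam (Free.gen p H g * Free.gen p H g') = op p R lam g * op p R lam g' -
      superSign (g.parity p) (g'.parity p) • (op p R lam g' * op p R lam g) := by
  rw [repLin_mul, repLin_gen, repLin_gen,
    comm_of_isHom (sigma_mul_sigma p) (isHom_op p R lam g) (isHom_op p R lam g')]

/-- The recursion defining `raise` is the rule for commuting `Xᵢ` past the first letter, so the
relations between `X` and `Y` hold by construction. Those involving `H` express that words and their
images are weight vectors, and the Lie superalgebra axioms hold for every supercommutator. -/
theorem repLin_rel {x : Free p H} (hx : Rel p R x) : repLin p R lam x = 0 := by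
  have hσ := sigma_mul_sigma p
  cases hx with
  | skew a b x y hx hy =>
    rw [map_add, map_smul, repLin_mul, repLin_mul]
    exact comm_skew hσ (isHom_repLin p R lam hx) (isHom_repLin p R lam hy)
  | jacobi a b x y z hx hy =>
    obtain ⟨z0, h0, z1, h1, rfl⟩ := exists_add_eq z
    have hx := isHom_repLin p R lam hx
    have hy := isHom_repLin p R lam hy
    have e0 := comm_jacobi hσ hx hy (isHom_repLin p R lam h0)
    have e1 := comm_jacobi hσ hx hy (isHom_repLin p R lam h1)
    have e := congrArg₂ (· + ·) e0 e1
    simp only [map_sub, map_add, map_smul, repLin_mul, comm_add_right, smul_add]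
    simp only [add_zero] at e
    rw [← e]
    abel
  | h_add v w =>
    simp only [map_sub, map_add, repLin_gen, op]
    refine end_ext fun u => ?_
    simp only [LinearMap.sub_apply, LinearMap.add_apply, opH_single, map_add]
    simp [add_smul]
  | h_smul c v =>
    simp only [map_sub, map_smul, repLin_gen, op]
    refine end_ext fun u => ?_
    simp only [LinearMap.sub_apply, LinearMap.smul_apply, opH_single, map_smul]
    simp
  | h_h v w =>
    rw [repLin_gen_mul]
    refine end_ext fun u => ?_
    simp only [LinearMap.sub_apply, Module.End.mul_apply, op, opH_single,
      map_smul, Gen.parity, superSign_zero_left, one_smul, LinearMap.zero_apply]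
    module
  | X_Y i =>
    rw [map_sub, repLin_gen_mul, repLin_gen]
    refine end_ext fun u => ?_
    simp [op, Gen.parity, raise]
  | X_Y_ne i j hij =>
    rw [repLin_gen_mul]
    refine end_ext fun u => ?_
    simp [op, Gen.parity, raise, hij]
  | h_X v i =>
    rw [map_sub, map_smul, repLin_gen_mul, repLin_gen]
    refine end_ext fun u => ?_
    simp only [op, Gen.parity, superSign_zero_left, one_smul, LinearMap.sub_apply,
      LinearMap.smul_apply, Module.End.mul_apply, opH_single, opX_single, map_smul, opH_raise,
      LinearMap.zero_apply]
    module
  | h_Y v i =>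
    rw [map_add, map_smul, repLin_gen_mul, repLin_gen]
    simp only [op, Gen.parity, superSign_zero_left, one_smul, opH_opY]
    module

theorem relIdeal_le_ker : relIdeal p R ≤ LinearMap.ker (repLin p R lam) :=
  sInf_le ⟨isIdeal_ker p R lam, fun _ hx => repLin_rel p R lam hx⟩

end Verma

/-- In the Verma module of highest weight `lam` the element `v` acts on the empty word by `lam v`,
and the functionals `lam` separate the points of `H`. -/
theorem GTilde.cartan_injective {ι : Type*} [Fintype ι] {A : Matrix ι ι ℂ} {H : Type*}
    [AddCommGroup H] [Module ℂ H] (p : ι → ZMod 2) (R : Realization A H) :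
    Function.Injective (GTilde.cartan p R) := by
  rw [injective_iff_map_eq_zero]
  intro v hv
  rw [← Module.forall_dual_apply_eq_zero_iff ℂ]
  intro lam
  have h : Free.gen p H (.h v) ∈ LinearMap.ker (Verma.repLin p R lam) :=
    Verma.relIdeal_le_ker p R lam ((Submodule.Quotient.mk_eq_zero _).mp hv)
  rw [LinearMap.mem_ker, Verma.repLin_gen] at h
  have h' := LinearMap.congr_fun h (Finsupp.single [] 1)
  rw [Verma.op, Verma.opH_single, LinearMap.zero_apply, smul_eq_zero] at h'
  exact h'.resolve_right (by simp)

end Contragredient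

/-! ### Triangular decomposition, uniformly for `g̃(A)` and `g(A)` -/

namespace Contragredient

open Superalgebra

section Quotient

theorem Free.eq_top_of_monomial {ι : Type*} (p : ι → ZMod 2) {H : Type*}
    {P : Submodule ℂ (Free p H)}
    (h : ∀ a x, Free.IsMonomial p H a x → x ∈ P) : P = ⊤ := by
  rw [eq_top_iff]
  intro x _
  have hle : ∀ a, Free.part p H a ≤ P := fun a => Submodule.span_le.mpr fun x hx => h a x hx
  exact sup_le (hle 0) (hle 1) (Free.mem_sup p H x)

variable {ι : Type*} [Fintype ι] {A : Matrix ι ι ℂ} {H : Type*} [AddCommGroup H] [Module ℂ H]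
  (p : ι → ZMod 2) (R : Realization A H)

/-- `π` presents the superalgebra `L` as a quotient of `g̃(A)`. -/
structure IsQuot {L : Type*} [AddCommGroup L] [Module ℂ L] [Superalgebra L]
    (π : Free p H →ₗ[ℂ] L) : Prop where
  surjective : Function.Surjective π
  map_mul : ∀ x y, π (x * y) = bracket (π x) (π y)
  map_part : ∀ a x, x ∈ Free.part p H a → π x ∈ part (L := L) a
  map_rel : ∀ x, Rel p R x → π x = 0

theorem GTilde.isQuot : IsQuot p R (GTilde.mk p R) where
  surjective := (relIdeal p R).mkQ_surjective
  map_mul _ _ := rfl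
  map_part _ x hx := ⟨x, hx, rfl⟩
  map_rel _ hx := GTilde.mk_eq_zero p R hx

/-- The quotient map from the free algebra to `g(A)`. -/
def G.proj : Free p H →ₗ[ℂ] G p R := G.mk p R ∘ₗ GTilde.mk p R

theorem G.isQuot : IsQuot p R (G.proj p R) where
  surjective := (maxIdeal p R).mkQ_surjective.comp (relIdeal p R).mkQ_surjective
  map_mul _ _ := rfl
  map_part _ x hx := ⟨GTilde.mk p R x, ⟨x, hx, rfl⟩, rfl⟩
  map_rel _ hx := by
    rw [G.proj, LinearMap.comp_apply, GTilde.mk_eq_zero p R hx, map_zero]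

end Quotient

/-- The iterated brackets `[x i₁, [x i₂, ..., [x iₙ, b]]]` with `b ∈ B`. -/
inductive AdWord {ι L : Type*} [AddCommGroup L] [Module ℂ L] [Superalgebra L] (x : ι → L)
    (B : Set L) : L → Prop
  | base (b : L) : b ∈ B → AdWord x B b
  | step (i : ι) (w : L) : AdWord x B w → AdWord x B (bracket (x i) w)

section AdWord

variable {ι L : Type*} [AddCommGroup L] [Module ℂ L] [Superalgebra L] {x y : ι → L} {B : Set L}

/-- The span of the iterated brackets. -/
def adSpan (x : ι → L) (B : Set L) : Submodule ℂ L := Submodule.span ℂ {w | AdWord x B w}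

theorem bracket_mem_of_span {S : Set L} {P : Submodule ℂ L} {z : L}
    (h : ∀ w ∈ S, bracket z w ∈ P) {w : L} (hw : w ∈ Submodule.span ℂ S) : bracket z w ∈ P :=
  (Submodule.span_le.mpr h : Submodule.span ℂ S ≤ P.comap (bracket z)) hw

theorem bracket_mem_adSpan (i : ι) {w : L} (hw : w ∈ adSpan x B) :
    bracket (x i) w ∈ adSpan x B :=
  bracket_mem_of_span (fun w hw => Submodule.subset_span (AdWord.step i w hw)) hw

theorem AdWord.exists_mem_part {p : ι → ZMod 2} (hx : ∀ i, x i ∈ part (L := L) (p i))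
    (hB : ∀ b ∈ B, ∃ a, b ∈ part (L := L) a) {w : L} (hw : AdWord x B w) :
    ∃ a, w ∈ part (L := L) a := by
  induction hw with
  | base b hb => exact hB b hb
  | step i w _ ih =>
    obtain ⟨a, ha⟩ := ih
    exact ⟨_, bracket_mem _ _ _ _ (hx i) ha⟩

variable [IsLieSuperalgebra L]

theorem AdWord.exists_smul {h : L} (hh : h ∈ part (L := L) 0)
    (hx : ∀ i, ∃ z : ℂ, bracket h (x i) = z • x i)
    (hB : ∀ b ∈ B, ∃ z : ℂ, bracket h b = z • b) {w : L} (hw : AdWord x B w) :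
    ∃ z : ℂ, bracket h w = z • w := by
  induction hw with
  | base b hb => exact hB b hb
  | step i w _ ih =>
    obtain ⟨z, hz⟩ := ih
    obtain ⟨u, hu⟩ := hx i
    refine ⟨u + z, ?_⟩
    rw [jacobi_even hh, hu, hz, map_smul, map_smul, LinearMap.smul_apply, add_smul]

theorem AdWord.exists_degree {h : L} (hh : h ∈ part (L := L) 0) {ε : ℂ}
    (hx : ∀ i, bracket h (x i) = ε • x i)
    (hB : ∀ b ∈ B, ∃ n : ℕ, bracket h b = (ε * (n + 1)) • b) {w : L} (hw : AdWord x B w) :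
    ∃ n : ℕ, bracket h w = (ε * (n + 1)) • w := by
  induction hw with
  | base b hb => exact hB b hb
  | step i w _ ih =>
    obtain ⟨n, hn⟩ := ih
    refine ⟨n + 1, ?_⟩
    rw [jacobi_even hh, hx, hn, map_smul, map_smul, LinearMap.smul_apply, ← add_smul]
    push_cast
    ring_nf

/-- The operator `ad (y j)` is moved through a word, each crossing leaving an element of `C`, which
preserves the span. `T` receives what is left when the base is reached: the Cartan part in
`IsQuot.triangular`, and `⊥` for a base killed by all `y j`. -/
theorem AdWord.bracket_mem {p : ι → ZMod 2} (hx : ∀ i, x i ∈ part (L := L) (p i))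
    (hy : ∀ i, y i ∈ part (L := L) (p i)) {C T : Submodule ℂ L}
    (hC : ∀ c ∈ C, ∀ w, AdWord x B w → bracket c w ∈ adSpan x B)
    (hyx : ∀ i j, bracket (y j) (x i) ∈ C) (hT : ∀ i, ∀ t ∈ T, bracket (x i) t ∈ adSpan x B)
    (j : ι) (hB : ∀ b ∈ B, bracket (y j) b ∈ T ⊔ adSpan x B) {w : L} (hw : AdWord x B w) :
    bracket (y j) w ∈ T ⊔ adSpan x B := by
  induction hw with
  | base b hb => exact hB b hb
  | step i w hw ih =>
    rw [IsLieSuperalgebra.jacobi _ _ _ _ _ (hy j) (hx i)]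
    refine Submodule.add_mem _ (Submodule.mem_sup_right (hC _ (hyx i j) _ hw))
      (Submodule.smul_mem _ _ (Submodule.mem_sup_right ?_))
    obtain ⟨t, ht, u, hu, e⟩ := Submodule.mem_sup.mp ih
    rw [← e, map_add]
    exact Submodule.add_mem _ (hT i t ht) (bracket_mem_adSpan i hu)

end AdWord

namespace IsQuot

variable {ι : Type*} [Fintype ι] {A : Matrix ι ι ℂ} {H : Type*} [AddCommGroup H] [Module ℂ H]
  {p : ι → ZMod 2} {R : Realization A H} {L : Type*} [AddCommGroup L] [Module ℂ L]
  [Superalgebra L] {π : Free p H →ₗ[ℂ] L}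

section Relations

theorem gen_mem (hπ : IsQuot p R π) (g : Gen ι H) :
    π (Free.gen p H g) ∈ part (L := L) (g.parity p) :=
  hπ.map_part _ _ (Submodule.subset_span (.gen g))

theorem X_mem (hπ : IsQuot p R π) (i : ι) : π (Free.gen p H (.X i)) ∈ part (L := L) (p i) :=
  hπ.gen_mem (.X i)

theorem Y_mem (hπ : IsQuot p R π) (i : ι) : π (Free.gen p H (.Y i)) ∈ part (L := L) (p i) :=
  hπ.gen_mem (.Y i)

theorem h_mem (hπ : IsQuot p R π) (v : H) : π (Free.gen p H (.h v)) ∈ part (L := L) 0 :=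
  hπ.gen_mem (.h v)

theorem h_h (hπ : IsQuot p R π) (v w : H) :
    bracket (π (Free.gen p H (.h v))) (π (Free.gen p H (.h w))) = 0 := by
  rw [← hπ.map_mul, hπ.map_rel _ (Rel.h_h v w)]

theorem X_Y (hπ : IsQuot p R π) (i : ι) :
    bracket (π (Free.gen p H (.X i))) (π (Free.gen p H (.Y i))) =
    π (Free.gen p H (.h (R.coroot i))) := by
  have h := hπ.map_rel _ (Rel.X_Y i)
  rwa [map_sub, hπ.map_mul, sub_eq_zero] at h

theorem X_Y_ne (hπ : IsQuot p R π) {i j : ι} (hij : i ≠ j) :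
    bracket (π (Free.gen p H (.X i))) (π (Free.gen p H (.Y j))) = 0 := by
  rw [← hπ.map_mul, hπ.map_rel _ (Rel.X_Y_ne i j hij)]

theorem h_X (hπ : IsQuot p R π) (v : H) (i : ι) :
    bracket (π (Free.gen p H (.h v))) (π (Free.gen p H (.X i))) =
    R.root i v • π (Free.gen p H (.X i)) := by
  have h := hπ.map_rel _ (Rel.h_X v i)
  rwa [map_sub, hπ.map_mul, map_smul, sub_eq_zero] at h

theorem h_Y (hπ : IsQuot p R π) (v : H) (i : ι) :
    bracket (π (Free.gen p H (.h v))) (π (Free.gen p H (.Y i))) =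
    -R.root i v • π (Free.gen p H (.Y i)) := by
  have h := hπ.map_rel _ (Rel.h_Y v i)
  rwa [map_add, hπ.map_mul, map_smul, add_eq_zero_iff_eq_neg, ← neg_smul] at h

/-- The canonical map from `H`. -/
def cartan (hπ : IsQuot p R π) : H →ₗ[ℂ] L where
  toFun v := π (Free.gen p H (.h v))
  map_add' v w := by
    have h := hπ.map_rel _ (Rel.h_add v w)
    rwa [map_sub, map_add, sub_eq_zero] at h
  map_smul' c v := by
    have h := hπ.map_rel _ (Rel.h_smul c v)
    rwa [map_sub, map_smul, sub_eq_zero] at h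

theorem cartan_apply (hπ : IsQuot p R π) (v : H) : hπ.cartan v = π (Free.gen p H (.h v)) := rfl

theorem X_Y_mem_range (hπ : IsQuot p R π) (i j : ι) :
    bracket (π (Free.gen p H (.X i))) (π (Free.gen p H (.Y j))) ∈
    LinearMap.range hπ.cartan := by
  by_cases hij : i = j
  · subst hij
    exact ⟨R.coroot i, (hπ.X_Y i).symm⟩
  · rw [hπ.X_Y_ne hij]
    exact zero_mem _

end Relations

variable [IsLieSuperalgebra L]

/-- By the Jacobi identity, stability of `P` under the adjoint operators of two monomials passes to
their product. -/
theorem bracket_mem (hπ : IsQuot p R π) {P : Submodule ℂ L}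
    (h : ∀ g, ∀ y ∈ P, bracket (π (Free.gen p H g)) y ∈ P) (x : L) {y : L} (hy : y ∈ P) :
    bracket x y ∈ P := by
  obtain ⟨x, rfl⟩ := hπ.surjective x
  let Q : Submodule ℂ (Free p H) :=
    { carrier := {x | ∀ y ∈ P, bracket (π x) y ∈ P}
      add_mem' := fun hx hx' y hy => by
        rw [map_add, map_add]
        exact P.add_mem (hx y hy) (hx' y hy)
      zero_mem' := fun y _ => by simp
      smul_mem' := fun c x hx y hy => by
        rw [map_smul, map_smul]
        exact P.smul_mem c (hx y hy) }
  have hQ : Q = ⊤ := by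
    refine Free.eq_top_of_monomial p fun a x hx => ?_
    induction hx with
    | gen g => exact h g
    | @mul a b x y hx hy ihx ihy =>
      intro z hz
      have e := IsLieSuperalgebra.jacobi a b (π x) (π y) z
        (hπ.map_part a x (Submodule.subset_span hx)) (hπ.map_part b y (Submodule.subset_span hy))
      rw [hπ.map_mul, eq_sub_of_add_eq e.symm]
      exact P.sub_mem (ihx _ (ihy _ hz)) (P.smul_mem _ (ihy _ (ihx _ hz)))
  have hx : x ∈ Q := hQ ▸ Submodule.mem_top
  exact hx y hy

theorem eq_top (hπ : IsQuot p R π) {P : Submodule ℂ L} (hg : ∀ g, π (Free.gen p H g) ∈ P)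
    (h : ∀ g, ∀ y ∈ P, bracket (π (Free.gen p H g)) y ∈ P) : P = ⊤ := by
  rw [eq_top_iff]
  intro x _
  obtain ⟨x, rfl⟩ := hπ.surjective x
  have hQ : P.comap π = ⊤ := by
    refine Free.eq_top_of_monomial p fun a x hx => ?_
    induction hx with
    | gen g => exact hg g
    | mul _ _ _ ihy =>
      rw [Submodule.mem_comap, hπ.map_mul]
      exact hπ.bracket_mem h _ ihy
  exact (hQ ▸ Submodule.mem_top : x ∈ P.comap π)

theorem isIdeal_span (hπ : IsQuot p R π) {S : Set L} (hS : ∀ x ∈ S, ∃ a, x ∈ part (L := L) a)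
    (h : ∀ g, ∀ x ∈ S, bracket (π (Free.gen p H g)) x ∈ Submodule.span ℂ S) :
    IsIdeal (Submodule.span ℂ S) := by
  have left : ∀ x y : L, y ∈ Submodule.span ℂ S → bracket x y ∈ Submodule.span ℂ S :=
    fun x y hy => hπ.bracket_mem (fun g y hy => bracket_mem_of_span (h g) hy) x hy
  refine ⟨left, fun x y hx => ?_, fun x hx => ?_⟩
  · induction hx using Submodule.span_induction with
    | mem x hx =>
      obtain ⟨a, ha⟩ := hS x hx
      obtain ⟨y0, h0, y1, h1, rfl⟩ := exists_add_eq y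
      rw [map_add, IsLieSuperalgebra.skew a 0 x y0 ha h0, IsLieSuperalgebra.skew a 1 x y1 ha h1]
      have hx' := Submodule.subset_span (R := ℂ) hx
      exact Submodule.add_mem _ (Submodule.neg_mem _ (Submodule.smul_mem _ _ (left _ _ hx')))
        (Submodule.neg_mem _ (Submodule.smul_mem _ _ (left _ _ hx')))
    | zero => simp
    | add x x' _ _ hx hx' =>
      rw [map_add]
      exact Submodule.add_mem _ hx hx'
    | smul c x _ hx =>
      rw [map_smul]
      exact Submodule.smul_mem _ _ hx
  · induction hx using Submodule.span_induction with
    | mem x hx =>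
      obtain ⟨a, ha⟩ := hS x hx
      have hx' := Submodule.subset_span (R := ℂ) hx
      rcases zmod_two_cases a with rfl | rfl
      · exact ⟨x, hx', 0, zero_mem _, ha, zero_mem _, (add_zero x).symm⟩
      · exact ⟨0, zero_mem _, x, hx', zero_mem _, ha, (zero_add x).symm⟩
    | zero => exact ⟨0, zero_mem _, 0, zero_mem _, zero_mem _, zero_mem _, (add_zero 0).symm⟩
    | add x x' _ _ hx hx' =>
      obtain ⟨y, hy, z, hz, h0, h1, rfl⟩ := hx
      obtain ⟨y', hy', z', hz', h0', h1', rfl⟩ := hx'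
      exact ⟨y + y', add_mem hy hy', z + z', add_mem hz hz', add_mem h0 h0', add_mem h1 h1',
        add_add_add_comm y z y' z'⟩
    | smul c x _ hx =>
      obtain ⟨y, hy, z, hz, h0, h1, rfl⟩ := hx
      exact ⟨c • y, Submodule.smul_mem _ c hy, c • z, Submodule.smul_mem _ c hz,
        Submodule.smul_mem _ c h0, Submodule.smul_mem _ c h1, smul_add c y z⟩

theorem Y_X (hπ : IsQuot p R π) (i j : ι) :
    ∃ z : ℂ, bracket (π (Free.gen p H (.Y j))) (π (Free.gen p H (.X i))) =
    z • bracket (π (Free.gen p H (.X i))) (π (Free.gen p H (.Y j))) :=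
  ⟨-superSign (p j) (p i), by
    rw [IsLieSuperalgebra.skew _ _ _ _ (hπ.Y_mem j) (hπ.X_mem i), neg_smul]⟩

theorem Y_X_mem_range (hπ : IsQuot p R π) (i j : ι) :
    bracket (π (Free.gen p H (.Y j))) (π (Free.gen p H (.X i))) ∈
    LinearMap.range hπ.cartan := by
  obtain ⟨z, hz⟩ := hπ.Y_X i j
  rw [hz]
  exact Submodule.smul_mem _ _ (hπ.X_Y_mem_range i j)

/-- The sum contains the generators and is stable under them: `X` preserves the positive part, maps
the Cartan part into it, and maps the negative part into Cartan plus negative; `Y` behaves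
symmetrically. -/
theorem triangular (hπ : IsQuot p R π) : adSpan (fun i => π (Free.gen p H (.X i)))
      (Set.range fun i => π (Free.gen p H (.X i))) ⊔ LinearMap.range hπ.cartan ⊔
    adSpan (fun i => π (Free.gen p H (.Y i))) (Set.range fun i => π (Free.gen p H (.Y i))) = ⊤ := by
  set X := fun i => π (Free.gen p H (.X i)) with hX
  set Y := fun i => π (Free.gen p H (.Y i)) with hY
  set U := adSpan X (Set.range X) with hU
  set C := LinearMap.range hπ.cartan with hC
  set D := adSpan Y (Set.range Y) with hD
  have XU : ∀ i, X i ∈ U := fun i => Submodule.subset_span (.base _ ⟨i, rfl⟩)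
  have YD : ∀ i, Y i ∈ D := fun i => Submodule.subset_span (.base _ ⟨i, rfl⟩)
  have hXw : ∀ v w, AdWord X (Set.range X) w → ∃ z : ℂ, bracket (hπ.cartan v) w = z • w :=
    fun v w hw => hw.exists_smul (hπ.h_mem v) (fun i => ⟨_, hπ.h_X v i⟩)
      (by rintro _ ⟨i, rfl⟩; exact ⟨_, hπ.h_X v i⟩)
  have hYw : ∀ v w, AdWord Y (Set.range Y) w → ∃ z : ℂ, bracket (hπ.cartan v) w = z • w :=
    fun v w hw => hw.exists_smul (hπ.h_mem v) (fun i => ⟨_, hπ.h_Y v i⟩)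
      (by rintro _ ⟨i, rfl⟩; exact ⟨_, hπ.h_Y v i⟩)
  have CU : ∀ c ∈ C, ∀ w, AdWord X (Set.range X) w → bracket c w ∈ U := by
    rintro _ ⟨v, rfl⟩ w hw
    obtain ⟨z, hz⟩ := hXw v w hw
    rw [hz]
    exact Submodule.smul_mem _ _ (Submodule.subset_span hw)
  have CD : ∀ c ∈ C, ∀ w, AdWord Y (Set.range Y) w → bracket c w ∈ D := by
    rintro _ ⟨v, rfl⟩ w hw
    obtain ⟨z, hz⟩ := hYw v w hw
    rw [hz]
    exact Submodule.smul_mem _ _ (Submodule.subset_span hw)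
  have XC : ∀ i, ∀ c ∈ C, bracket (X i) c ∈ U := by
    rintro i _ ⟨v, rfl⟩
    rw [hπ.cartan_apply, ← neg_neg (bracket _ _), ← skew_even (hπ.h_mem v), hπ.h_X]
    exact Submodule.neg_mem _ (Submodule.smul_mem _ _ (XU i))
  have YC : ∀ i, ∀ c ∈ C, bracket (Y i) c ∈ D := by
    rintro i _ ⟨v, rfl⟩
    rw [hπ.cartan_apply, ← neg_neg (bracket _ _), ← skew_even (hπ.h_mem v), hπ.h_Y]
    exact Submodule.neg_mem _ (Submodule.smul_mem _ _ (YD i))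
  have YU : ∀ j, ∀ w ∈ U, bracket (Y j) w ∈ C ⊔ U := fun j w hw =>
    bracket_mem_of_span (fun w hw => AdWord.bracket_mem (p := p) hπ.X_mem hπ.Y_mem CU
      (fun i j => hπ.Y_X_mem_range i j) XC j
      (by rintro _ ⟨i, rfl⟩; exact Submodule.mem_sup_left (hπ.Y_X_mem_range i j)) hw) hw
  have XD : ∀ j, ∀ w ∈ D, bracket (X j) w ∈ C ⊔ D := fun j w hw =>
    bracket_mem_of_span (fun w hw => AdWord.bracket_mem (p := p) hπ.Y_mem hπ.X_mem CD
      (fun i j => hπ.X_Y_mem_range j i) YC j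
      (by rintro _ ⟨i, rfl⟩; exact Submodule.mem_sup_left (hπ.X_Y_mem_range j i)) hw) hw
  have leU : U ≤ U ⊔ C ⊔ D := le_sup_left.trans le_sup_left
  have leC : C ≤ U ⊔ C ⊔ D := le_sup_right.trans le_sup_left
  have leD : D ≤ U ⊔ C ⊔ D := le_sup_right
  refine hπ.eq_top (fun g => ?_) fun g y hy => ?_
  · cases g with
    | X i => exact leU (XU i)
    | Y i => exact leD (YD i)
    | h v => exact leC ⟨v, rfl⟩
  · suffices h : U ⊔ C ⊔ D ≤ (U ⊔ C ⊔ D).comap (bracket (π (Free.gen p H g))) from h hy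
    refine sup_le (sup_le (fun w hw => ?_) (fun w hw => ?_)) (fun w hw => ?_) <;>
      rw [Submodule.mem_comap] <;> cases g with
    | X i => ?_
    | Y i => ?_
    | h v => ?_
    · exact leU (bracket_mem_adSpan i hw)
    · exact sup_le leC leU (YU i w hw)
    · exact leU (bracket_mem_of_span (fun w hw => CU _ ⟨v, rfl⟩ w hw) hw)
    · exact leU (XC i w hw)
    · exact leD (YC i w hw)
    · obtain ⟨u, rfl⟩ := hw
      rw [hπ.cartan_apply, hπ.h_h]
      exact zero_mem _
    · exact sup_le leC leD (XD i w hw)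
    · exact leD (bracket_mem_adSpan i hw)
    · exact leD (bracket_mem_of_span (fun w hw => CD _ ⟨v, rfl⟩ w hw) hw)

end IsQuot

end Contragredient

/-! ### Subspaces stable under a diagonalizable operator -/

/-- The sum of the eigenspaces of `D` for nonzero eigenvalues. -/
def Module.End.nonzeroPart {V : Type*} [AddCommGroup V] [Module ℂ V] (D : Module.End ℂ V) :
    Submodule ℂ V := ⨆ (μ : ℂ) (_ : μ ≠ 0), D.eigenspace μ

namespace Module.End

variable {V : Type*} [AddCommGroup V] [Module ℂ V] {D : Module.End ℂ V}

theorem mem_nonzeroPart {μ : ℂ} (hμ : μ ≠ 0) {x : V} (hx : D x = μ • x) : x ∈ D.nonzeroPart :=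
  (le_iSup₂_of_le μ hμ le_rfl : D.eigenspace μ ≤ D.nonzeroPart) (mem_eigenspace_iff.mpr hx)

theorem eq_zero_of_mem_nonzeroPart {x : V} (hx : x ∈ D.nonzeroPart) (h0 : D x = 0) : x = 0 := by
  refine Submodule.disjoint_def.mp (D.eigenspaces_iSupIndep 0) x ?_ hx
  rw [mem_eigenspace_iff, h0, zero_smul]

theorem le_nonzeroPart {J : Submodule ℂ V} (htop : ⨆ μ, D.eigenspace μ = ⊤)
    (hJ : ∀ x ∈ J, D x ∈ J) (h0 : ∀ x ∈ J, D x = 0 → x = 0) : J ≤ D.nonzeroPart := by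
  classical
  intro x hx
  have hx' : x ∈ ⨆ μ, D.eigenspace μ := htop ▸ Submodule.mem_top
  obtain ⟨m, hm, rfl⟩ := (Submodule.mem_iSup_iff_exists_finsupp _ _).mp hx'
  have hpow : ∀ (k : ℕ) (y : V), y ∈ J → (D ^ k) y ∈ J := by
    intro k
    induction k with
    | zero => simp
    | succ k ih =>
      intro y hy
      rw [pow_succ, Module.End.mul_apply]
      exact ih _ (hJ y hy)
  -- Applying `P` to `D` kills every component of nonzero eigenvalue and rescales the component `m
  -- 0` by a nonzero number. Hence `m 0` lies in `J` and is zero by assumption.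
  let P : Polynomial ℂ := ∏ ν ∈ m.support.erase 0, (Polynomial.X - Polynomial.C ν)
  have hP0 : P.eval 0 ≠ 0 := by
    rw [Polynomial.eval_prod]
    refine Finset.prod_ne_zero_iff.mpr fun ν hν => ?_
    simpa using (Finset.mem_erase.mp hν).1
  have hPx : Polynomial.aeval D P (m.sum fun _ y => y) = P.eval 0 • m 0 := by
    rw [Finsupp.sum, map_sum]
    have hterm : ∀ μ, Polynomial.aeval D P (m μ) = P.eval μ • m μ := fun μ =>
      aeval_apply_of_mem_apply_eq_smul (mem_eigenspace_iff.mp (hm μ))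
    rw [Finset.sum_eq_single 0]
    · exact hterm 0
    · intro μ hμ hμ0
      rw [hterm, Polynomial.eval_prod,
        Finset.prod_eq_zero (Finset.mem_erase.mpr ⟨hμ0, hμ⟩) (by simp), zero_smul]
    · intro h
      rw [hterm, Finsupp.notMem_support_iff.mp h, smul_zero]
  have hmem : Polynomial.aeval D P (m.sum fun _ y => y) ∈ J := by
    rw [Polynomial.aeval_endomorphism, Polynomial.sum]
    exact Submodule.sum_mem _ fun k _ => Submodule.smul_mem _ _ (hpow k _ hx)
  rw [hPx] at hmem
  have hm0 : m 0 = 0 := by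
    refine h0 _ ?_ ?_
    · have := J.smul_mem (P.eval 0)⁻¹ hmem
      rwa [smul_smul, inv_mul_cancel₀ hP0, one_smul] at this
    · rw [mem_eigenspace_iff.mp (hm 0), zero_smul]
  refine Submodule.sum_mem _ fun μ hμ => mem_nonzeroPart ?_ (mem_eigenspace_iff.mp (hm μ))
  rintro rfl
  exact Finsupp.mem_support_iff.mp hμ hm0

end Module.End

/-! ### The principal grading and the ideals of `g(A)` -/

namespace Contragredient

open Superalgebra

variable {ι : Type*} [Fintype ι] {A : Matrix ι ι ℂ} {H : Type*} [AddCommGroup H] [Module ℂ H]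

namespace Realization

/-- Independence of the roots permits prescribing the values of a functional on `H*`, and `H` is
reflexive. -/
theorem exists_grading (R : Realization A H) : ∃ v : H, ∀ i, R.root i v = 1 := by
  have := R.finiteDimensional
  obtain ⟨g, hg⟩ := LinearMap.exists_extend
    (Finsupp.linearCombination ℂ (fun _ : ι => (1 : ℂ)) ∘ₗ R.root_indep.repr)
  refine ⟨(Module.evalEquiv ℂ H).symm g, fun i => ?_⟩
  rw [Module.apply_evalEquiv_symm_apply]
  have hi : R.root i ∈ Submodule.span ℂ (Set.range R.root) := Submodule.subset_span ⟨i, rfl⟩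
  have h := LinearMap.congr_fun hg ⟨R.root i, hi⟩
  have hr : R.root_indep.repr ⟨R.root i, hi⟩ = Finsupp.single i 1 :=
    R.root_indep.repr_eq_single i _ rfl
  simpa [hr] using h

/-- An element of `H` on which all simple roots are equal to `1`. -/
def grading (R : Realization A H) : H := R.exists_grading.choose

theorem root_grading (R : Realization A H) (i : ι) : R.root i R.grading = 1 :=
  R.exists_grading.choose_spec i

end Realization

namespace IsQuot

variable {p : ι → ZMod 2} {R : Realization A H} {L : Type*} [AddCommGroup L] [Module ℂ L]
  [Superalgebra L] {π : Free p H →ₗ[ℂ] L}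

/-- The degree operator of the principal grading. -/
def degree (hπ : IsQuot p R π) : Module.End ℂ L := bracket (hπ.cartan R.grading)

theorem degree_X (hπ : IsQuot p R π) (i : ι) :
    hπ.degree (π (Free.gen p H (.X i))) = (1 : ℂ) • π (Free.gen p H (.X i)) := by
  rw [degree, cartan_apply, hπ.h_X, R.root_grading]

theorem degree_Y (hπ : IsQuot p R π) (i : ι) :
    hπ.degree (π (Free.gen p H (.Y i))) = (-1 : ℂ) • π (Free.gen p H (.Y i)) := by
  rw [degree, cartan_apply, hπ.h_Y, R.root_grading]

theorem degree_cartan (hπ : IsQuot p R π) (v : H) : hπ.degree (hπ.cartan v) = 0 := hπ.h_h _ _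

variable [IsLieSuperalgebra L]

theorem adSpan_X_le (hπ : IsQuot p R π) {B : Set L}
    (hB : ∀ b ∈ B, ∃ n : ℕ, hπ.degree b = (n + 1 : ℂ) • b) :
    adSpan (fun i => π (Free.gen p H (.X i))) B ≤ hπ.degree.nonzeroPart := by
  refine Submodule.span_le.mpr fun w hw => ?_
  obtain ⟨n, hn⟩ := AdWord.exists_degree (hπ.h_mem R.grading) hπ.degree_X
    (fun b hb => (hB b hb).imp fun n hn => by rw [one_mul]; exact hn) hw
  rw [one_mul] at hn
  exact Module.End.mem_nonzeroPart (n.cast_add_one_ne_zero) hn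

theorem adSpan_Y_le (hπ : IsQuot p R π) {B : Set L}
    (hB : ∀ b ∈ B, ∃ n : ℕ, hπ.degree b = (-1 * (n + 1) : ℂ) • b) :
    adSpan (fun i => π (Free.gen p H (.Y i))) B ≤ hπ.degree.nonzeroPart := by
  refine Submodule.span_le.mpr fun w hw => ?_
  obtain ⟨n, hn⟩ := AdWord.exists_degree (hπ.h_mem R.grading) hπ.degree_Y hB hw
  exact Module.End.mem_nonzeroPart
    (mul_ne_zero (neg_ne_zero.mpr one_ne_zero) n.cast_add_one_ne_zero) hn

theorem exists_cartan_add (hπ : IsQuot p R π) (x : L) :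
    ∃ v : H, ∃ y ∈ hπ.degree.nonzeroPart, x = hπ.cartan v + y := by
  have hx : x ∈ (⊤ : Submodule ℂ L) := Submodule.mem_top
  rw [← hπ.triangular, sup_comm _ (LinearMap.range _), sup_assoc, Submodule.mem_sup] at hx
  obtain ⟨_, ⟨v, rfl⟩, y, hy, rfl⟩ := hx
  refine ⟨v, y, sup_le (hπ.adSpan_X_le ?_) (hπ.adSpan_Y_le ?_) hy, rfl⟩
  · rintro _ ⟨i, rfl⟩
    exact ⟨0, by simpa using hπ.degree_X i⟩
  · rintro _ ⟨i, rfl⟩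
    exact ⟨0, by simpa using hπ.degree_Y i⟩

theorem iSup_eigenspace_degree (hπ : IsQuot p R π) : ⨆ μ, hπ.degree.eigenspace μ = ⊤ := by
  rw [eq_top_iff]
  intro x _
  obtain ⟨v, y, hy, rfl⟩ := hπ.exists_cartan_add x
  refine Submodule.add_mem _ (Submodule.mem_iSup_of_mem 0 ?_) ?_
  · rw [Module.End.mem_eigenspace_iff, hπ.degree_cartan, zero_smul]
  · exact (iSup₂_le fun μ _ => le_iSup hπ.degree.eigenspace μ :
      hπ.degree.nonzeroPart ≤ _) hy

theorem mem_range_of_degree_eq_zero (hπ : IsQuot p R π) {x : L} (hx : hπ.degree x = 0) :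
    x ∈ LinearMap.range hπ.cartan := by
  obtain ⟨v, y, hy, rfl⟩ := hπ.exists_cartan_add x
  rw [map_add, hπ.degree_cartan, zero_add] at hx
  rw [Module.End.eq_zero_of_mem_nonzeroPart hy hx, add_zero]
  exact ⟨v, rfl⟩

end IsQuot

variable (p : ι → ZMod 2) (R : Realization A H)

/-- The degree zero part of `g̃(A)` is exactly the Cartan part, so an ideal meeting the latter
trivially lies in nonzero degrees. Unlike trivial intersection, this property passes to sums, so
`r(A)` itself meets the Cartan part trivially. -/
theorem maxIdeal_le : maxIdeal p R ≤ (GTilde.isQuot p R).degree.nonzeroPart := by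
  refine sSup_le fun J hJ => ?_
  refine Module.End.le_nonzeroPart (GTilde.isQuot p R).iSup_eigenspace_degree
    (fun x hx => hJ.1.left _ x hx) fun x hx h0 => ?_
  have h : x ∈ J ⊓ LinearMap.range (GTilde.cartan p R) :=
    ⟨hx, (GTilde.isQuot p R).mem_range_of_degree_eq_zero h0⟩
  rw [hJ.2] at h
  exact h

theorem G.cartan_injective : Function.Injective (G.cartan p R) := by
  rw [injective_iff_map_eq_zero]
  intro v hv
  have h : GTilde.cartan p R v ∈ maxIdeal p R := (Submodule.Quotient.mk_eq_zero _).mp hv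
  have h' := Module.End.eq_zero_of_mem_nonzeroPart (maxIdeal_le p R h)
    ((GTilde.isQuot p R).degree_cartan v)
  exact (injective_iff_map_eq_zero _).mp (GTilde.cartan_injective p R) v h'

variable {p R}

theorem isIdeal_comap_mk {J : Submodule ℂ (G p R)} (hJ : IsIdeal J) :
    IsIdeal (J.comap (G.mk p R)) where
  left x y hy := hJ.left (G.mk p R x) (G.mk p R y) hy
  right x y hx := hJ.right (G.mk p R x) (G.mk p R y) hx
  graded x hx := by
    obtain ⟨x0, h0, x1, h1, rfl⟩ := exists_add_eq x
    obtain ⟨y, hy, z, hz, hy0, hz1, e⟩ := hJ.graded _ hx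
    rw [map_add] at e
    have h0' : G.mk p R x0 ∈ part (L := G p R) 0 := ⟨x0, h0, rfl⟩
    have h1' : G.mk p R x1 ∈ part (L := G p R) 1 := ⟨x1, h1, rfl⟩
    obtain ⟨e0, e1⟩ := eq_of_add_eq h0' hy0 h1' hz1 e
    exact ⟨x0, by rw [Submodule.mem_comap, e0]; exact hy, x1,
      by rw [Submodule.mem_comap, e1]; exact hz, h0, h1, rfl⟩

/-- The preimage of `J` in `g̃(A)` is one of the ideals whose sum is `r(A)`, since a Cartan element
in it has degree zero and must vanish. -/
theorem G.eq_bot_of_isIdeal {J : Submodule ℂ (G p R)} (hJ : IsIdeal J)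
    (h : J ≤ (G.isQuot p R).degree.nonzeroPart) : J = ⊥ := by
  have hle : J.comap (G.mk p R) ≤ maxIdeal p R := by
    refine le_sSup ⟨isIdeal_comap_mk hJ, ?_⟩
    rw [eq_bot_iff]
    rintro _ ⟨hx, v, rfl⟩
    have h0 : G.cartan p R v = 0 :=
      Module.End.eq_zero_of_mem_nonzeroPart (h hx) ((G.isQuot p R).degree_cartan v)
    rw [(injective_iff_map_eq_zero _).mp (G.cartan_injective p R) v h0, map_zero]
    exact zero_mem _
  rw [eq_bot_iff]
  intro x hx
  obtain ⟨x, rfl⟩ := (maxIdeal p R).mkQ_surjective x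
  exact (Submodule.Quotient.mk_eq_zero _).mpr (hle hx)

/-- The weight `∑ cᵢ αᵢ`. -/
def wt (R : Realization A H) (c : ι → ℤ) : Module.Dual ℂ H := ∑ i, c i • R.root i

theorem wt_grading (c : ι → ℤ) : wt R c R.grading = (∑ i, c i : ℤ) := by
  simp [wt, LinearMap.sum_apply, R.root_grading]

/-- The brackets of `x` with words in the `Xᵢ` already span an ideal, since `Y` sends `x` to zero.
All its degrees are positive, so the ideal is zero. -/
theorem G.eq_zero_of_bracket_Y {a : ZMod 2} {c : ι → ℤ} {x : G p R}
    (ha : x ∈ part (L := G p R) a) (hx : x ∈ rootSpace p R (wt R c)) (hc : 0 < ∑ i, c i)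
    (hY : ∀ j, bracket (G.Y p R j) x = 0) : x = 0 := by
  have hπ := G.isQuot p R
  have hW : ∀ v w, AdWord (G.X p R) {x} w → ∃ z : ℂ, bracket (G.cartan p R v) w = z • w :=
    fun v w hw => hw.exists_smul (hπ.h_mem v) (fun i => ⟨_, hπ.h_X v i⟩)
      (by rintro _ rfl; exact ⟨_, hx v⟩)
  have hCW : ∀ v w, AdWord (G.X p R) {x} w → bracket (G.cartan p R v) w ∈ adSpan (G.X p R) {x} := by
    intro v w hw
    obtain ⟨z, hz⟩ := hW v w hw
    rw [hz]
    exact Submodule.smul_mem _ _ (Submodule.subset_span hw)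
  have hI : IsIdeal (adSpan (G.X p R) {x}) := by
    refine hπ.isIdeal_span (fun w hw => hw.exists_mem_part (p := p) hπ.X_mem
      (by rintro _ rfl; exact ⟨a, ha⟩)) fun g w hw => ?_
    cases g with
    | X i => exact Submodule.subset_span (AdWord.step i w hw)
    | Y j =>
      have h := AdWord.bracket_mem (p := p) (y := G.Y p R)
        (C := LinearMap.range (G.cartan p R)) (T := ⊥) hπ.X_mem hπ.Y_mem
        (by rintro _ ⟨v, rfl⟩ w hw; exact hCW v w hw) hπ.Y_X_mem_range
        (by
          intro i t ht
          rw [(Submodule.mem_bot ℂ).mp ht, map_zero]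
          exact zero_mem _)
        j (by rintro _ rfl; rw [hY j]; exact zero_mem _) hw
      rwa [bot_sup_eq] at h
    | h v => exact hCW v w hw
  have hle : adSpan (G.X p R) {x} ≤ hπ.degree.nonzeroPart := by
    refine hπ.adSpan_X_le ?_
    rintro _ rfl
    obtain ⟨n, hn⟩ := Int.eq_succ_of_zero_lt hc
    refine ⟨n, (hx R.grading).trans ?_⟩
    rw [wt_grading, hn]
    push_cast
    rfl
  have h := G.eq_bot_of_isIdeal hI hle
  rw [← Submodule.mem_bot ℂ, ← h]
  exact Submodule.subset_span (.base x rfl)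

theorem G.X_ne_zero (i : ι) : G.X p R i ≠ 0 := by
  intro h
  have e : G.cartan p R (R.coroot i) = 0 := by
    refine ((G.isQuot p R).X_Y i).symm.trans ?_
    change bracket (G.X p R i) _ = 0
    rw [h, map_zero, LinearMap.zero_apply]
  exact R.coroot_indep.ne_zero i ((injective_iff_map_eq_zero _).mp (G.cartan_injective p R) _ e)

end Contragredient

/-! ### Ladders contradict finite growth -/

namespace Contragredient

open Superalgebra

variable {ι : Type*} [Fintype ι] {A : Matrix ι ι ℂ} {H : Type*} [AddCommGroup H] [Module ℂ H]
  {p : ι → ZMod 2} {R : Realization A H}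

theorem wt_add (c c' : ι → ℤ) : wt R (c + c') = wt R c + wt R c' := by
  simp [wt, add_smul, Finset.sum_add_distrib]

theorem wt_nsmul (n : ℕ) (c : ι → ℤ) : wt R (n • c) = n • wt R c := by
  induction n with
  | zero => simp [wt]
  | succ n ih => rw [succ_nsmul, succ_nsmul, wt_add, ih]

theorem wt_single [DecidableEq ι] (i : ι) (n : ℤ) : wt R (Pi.single i n) = n • R.root i := by
  rw [wt, Finset.sum_eq_single i]
  · rw [Pi.single_eq_same]
  · intro j _ hj
    rw [Pi.single_eq_of_ne hj, zero_smul]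
  · simp

theorem bracket_mem_rootSpace {μ ν : Module.Dual ℂ H} {x y : G p R} (hx : x ∈ rootSpace p R μ)
    (hy : y ∈ rootSpace p R ν) : bracket x y ∈ rootSpace p R (μ + ν) := by
  intro v
  have hv : G.cartan p R v ∈ part (L := G p R) 0 := (G.isQuot p R).h_mem v
  rw [jacobi_even hv, hx v, hy v, map_smul,
    map_smul, LinearMap.smul_apply, LinearMap.add_apply, add_smul]

theorem rank_finset_sup_le {V κ : Type*} [AddCommGroup V] [Module ℂ V] (s : Finset κ)
    (P : κ → Submodule ℂ V) {N : ℕ} (h : ∀ m ∈ s, Module.rank ℂ (P m) ≤ (N : Cardinal)) :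
    Module.rank ℂ (s.sup P : Submodule ℂ V) ≤ ((s.card * N : ℕ) : Cardinal) := by
  classical
  induction s using Finset.induction_on with
  | empty => simp
  | insert a s ha ih =>
    rw [Finset.sup_insert, Finset.card_insert_of_notMem ha]
    refine (Submodule.rank_add_le_rank_add_rank _ _).trans ?_
    refine (add_le_add (h a (Finset.mem_insert_self _ _))
      (ih fun m hm => h m (Finset.mem_insert_of_mem hm))).trans ?_
    norm_cast
    exact le_of_eq (by ring)

/-- Adding the bounds over the degrees from `0` to `M` costs one more power of `M + 1`. -/
theorem FiniteGrowth.exists_card_le (hfg : FiniteGrowth p R) : ∃ C d : ℕ, ∀ (M : ℕ) {κ : Type}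
    [Fintype κ] (u : κ → G p R), LinearIndependent ℂ u →
    (∀ k, ∃ c : ι → ℤ, u k ∈ rootSpace p R (wt R c) ∧ 0 ≤ ∑ i, c i ∧ ∑ i, c i ≤ M) →
    Fintype.card κ ≤ C * (M + 1) ^ (d + 1) := by
  obtain ⟨C, d, h⟩ := hfg
  refine ⟨C, d, fun M κ _ u hu hmem => ?_⟩
  let W := (Finset.range (M + 1)).sup fun m : ℕ => principalPart p R m
  have hW : Module.rank ℂ W ≤ (((M + 1) * (C * (M + 1) ^ d) : ℕ) : Cardinal) := by
    have := rank_finset_sup_le (Finset.range (M + 1)) (fun m : ℕ => principalPart p R m)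
      (N := C * (M + 1) ^ d) fun m hm => (h m).trans ?_
    · rwa [Finset.card_range] at this
    · have hm' : m + 1 ≤ M + 1 := Finset.mem_range.mp hm
      rw [Int.natAbs_natCast]
      exact_mod_cast Nat.mul_le_mul_left C (Nat.pow_le_pow_left hm' d)
  have huW : ∀ k, u k ∈ W := by
    intro k
    obtain ⟨c, hc, h0, h1⟩ := hmem k
    obtain ⟨m, hm⟩ := Int.eq_ofNat_of_zero_le h0
    have hmM : m ∈ Finset.range (M + 1) := by
      rw [Finset.mem_range]
      omega
    refine (Finset.le_sup (f := fun m : ℕ => principalPart p R m) hmM) ?_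
    exact (le_iSup₂_of_le c hm le_rfl : rootSpace p R (wt R c) ≤ principalPart p R m) hc
  have hu' : LinearIndependent ℂ fun k => (⟨u k, huW k⟩ : W) :=
    LinearIndependent.of_comp W.subtype hu
  have h1 := hu'.cardinal_lift_le_rank.trans (Cardinal.lift_le.mpr hW)
  simp only [Cardinal.mk_fintype, Cardinal.lift_natCast, Nat.cast_le] at h1
  refine h1.trans (le_of_eq ?_)
  ring

section Ladder

variable {a b c : ℂ} {q : ZMod 2} (S : Ladder (G p R) a b c q) {cX ce : ι → ℤ}

theorem up_mem_rootSpace (hX : S.X ∈ rootSpace p R (wt R cX)) (he : S.e ∈ rootSpace p R (wt R ce))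
    (n : ℕ) : S.up n ∈ rootSpace p R (wt R (ce + n • cX)) := by
  induction n with
  | zero => simpa [Ladder.up_zero] using he
  | succ n ih =>
    rw [Ladder.up_succ, succ_nsmul, ← add_assoc, wt_add, add_comm]
    exact bracket_mem_rootSpace hX ih

theorem word_mem_rootSpace (hX : S.X ∈ rootSpace p R (wt R cX))
    (he : S.e ∈ rootSpace p R (wt R ce)) {v : G p R} {cv : ι → ℤ}
    (hv : v ∈ rootSpace p R (wt R cv)) (g : ℕ → ℕ) (r : ℕ) : S.word v g r ∈
      rootSpace p R (wt R (cv + r • ce + (∑ i ∈ Finset.range r, g i) • cX)) := by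
  induction r with
  | zero => simpa [Ladder.word] using hv
  | succ r ih =>
    have h := bracket_mem_rootSpace (up_mem_rootSpace S hX he (g r)) ih
    rw [← wt_add] at h
    rw [Ladder.word, Finset.sum_range_succ]
    convert h using 3
    module

/-- With `s = d + 2` blocks there are `B ^ (d + 2)` independent words of degree linear in `B`, but
growth permits only a constant times `B ^ (d + 1)`. The hypothesis `H` supplies, for each word
length, a starting vector killed by almost all `fₖ` such that the Cartan parts of the `[fₖ, eₖ]`
never act by zero on the words built on it. -/
theorem not_finiteGrowth_of_ladder (hc : ∀ l : ℕ, a + (l + 1) * c / 2 ≠ 0) {vh vk : H}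
    (hh : S.h = G.cartan p R vh) (hk : S.k = G.cartan p R vk)
    (hX : S.X ∈ rootSpace p R (wt R cX)) (he : S.e ∈ rootSpace p R (wt R ce)) {nX ne : ℕ}
    (hnX : ∑ i, cX i = nX) (hne : ∑ i, ce i = ne)
    (H : ∀ s : ℕ, ∃ (v : G p R) (cv : ι → ℤ) (K nv : ℕ), v ≠ 0 ∧ v ∈ rootSpace p R (wt R cv) ∧
      ∑ i, cv i = nv ∧ (∀ k, K < k → bracket (S.down k) v = 0) ∧
      ∀ t < s, ∀ k : ℕ, K < k → ∀ n : ℕ, wt R (cv + t • ce + n • cX) (a • vk + (k * b) • vh) ≠ 0) :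
    ¬ FiniteGrowth p R := by
  intro hfg
  obtain ⟨C, d, hcard⟩ := hfg.exists_card_le
  obtain ⟨v, cv, K, nv, hv0, hv, hnv, hkill, hne0⟩ := H (d + 2)
  set s := d + 2 with hs
  have hnorm : ∀ n, Ladder.norm a c n ≠ 0 := fun n => Finset.prod_ne_zero_iff.mpr fun l _ => by
    rw [Ladder.coeff]
    refine mul_ne_zero (by exact_mod_cast Nat.succ_ne_zero (l + 1)) ?_
    have := hc l
    push_cast
    exact this
  have hind : ∀ B, LinearIndependent ℂ fun φ : Fin s → Fin B =>
      S.word v (Ladder.blockExponent (K + 1) B φ) s := by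
    intro B
    refine S.linearIndependent_word hv0 (fun k hk => hkill k hk) fun φ i hi => ?_
    have hw := word_mem_rootSpace S hX he hv (Ladder.blockExponent (K + 1) B φ) i
    have hK := Ladder.le_blockExponent (K + 1) B φ i
    obtain ⟨k, hk'⟩ := Nat.exists_eq_add_one_of_ne_zero (Nat.ne_zero_of_lt hK)
    have hb : bracket (S.down (Ladder.blockExponent (K + 1) B φ i))
        (S.up (Ladder.blockExponent (K + 1) B φ i)) = G.cartan p R (Ladder.norm a c k •
          (a • vk + ((Ladder.blockExponent (K + 1) B φ i : ℕ) * b) • vh)) := by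
      rw [hk', S.down_up_self, hh, hk]
      simp only [map_add, map_smul]
    refine ⟨_, ?_, (congrArg (fun z => bracket z _) hb).trans (hw _)⟩
    rw [map_smul, smul_eq_mul]
    exact mul_ne_zero (hnorm k) (hne0 i hi _ hK _)
  -- `D` makes the degree bound plus one at most `D * B`, and `B` is chosen just above the resulting
  -- constant `C * D ^ (d + 1)`.
  let D := nv + s * ne + s * (K + 1) * nX + 2 * s * s * nX + 1
  let B := C * D ^ (d + 1) + 1
  have key := hcard (nv + s * ne + s * (K + 1 + 2 * (s * B)) * nX) _ (hind B) fun φ => by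
    refine ⟨_, word_mem_rootSpace S hX he hv _ s, ?_⟩
    have hsum : ∑ i ∈ Finset.range s, Ladder.blockExponent (K + 1) B φ i ≤
        s * (K + 1 + 2 * (s * B)) := by
      have := Finset.sum_le_card_nsmul (Finset.range s) (Ladder.blockExponent (K + 1) B φ)
        (K + 1 + 2 * (s * B)) fun i hi =>
          Ladder.blockExponent_le (K + 1) B φ (Finset.mem_range.mp hi)
      simpa using this
    have e : ∑ i, (cv + s • ce + (∑ i ∈ Finset.range s,
        Ladder.blockExponent (K + 1) B φ i) • cX) i = ((nv + s * ne +
          (∑ i ∈ Finset.range s, Ladder.blockExponent (K + 1) B φ i) * nX : ℕ) : ℤ) := by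
      simp only [Pi.add_apply, Pi.smul_apply, Finset.sum_add_distrib, ← Finset.smul_sum, hnX, hne,
        hnv]
      simp only [nsmul_eq_mul]
      push_cast
      ring
    rw [e]
    refine ⟨Int.natCast_nonneg _, ?_⟩
    exact_mod_cast Nat.add_le_add_left (Nat.mul_le_mul_right nX hsum) _
  rw [Fintype.card_fun, Fintype.card_fin, Fintype.card_fin] at key
  have hB : 1 ≤ B := Nat.le_add_left 1 _
  have hM : nv + s * ne + s * (K + 1 + 2 * (s * B)) * nX + 1 ≤ D * B := by
    have h1 : nv + s * ne + s * (K + 1) * nX + 1 ≤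
        (nv + s * ne + s * (K + 1) * nX + 1) * B := Nat.le_mul_of_pos_right _ hB
    calc _ = (nv + s * ne + s * (K + 1) * nX + 1) + 2 * s * s * nX * B := by ring
      _ ≤ (nv + s * ne + s * (K + 1) * nX + 1) * B + 2 * s * s * nX * B := by gcongr
      _ = D * B := by simp only [D]; ring
  have h2 : B ^ s ≤ (C * D ^ (d + 1)) * B ^ (d + 1) :=
    key.trans ((Nat.mul_le_mul_left C (Nat.pow_le_pow_left hM _)).trans
      (le_of_eq (by rw [mul_pow]; ring)))
  have h3 : B ^ s = B * B ^ (d + 1) := by rw [hs]; ring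
  rw [h3] at h2
  have h4 := Nat.le_of_mul_le_mul_right h2 (Nat.pow_pos hB)
  simp only [B] at h4
  omega

end Ladder

end Contragredient

/-! ### Local nilpotency of adjoint operators -/

namespace Superalgebra

variable {L : Type*} [AddCommGroup L] [Module ℂ L] [Superalgebra L]

theorem bracket_self_mem {a : ZMod 2} {x : L} (hx : x ∈ part (L := L) a) :
    bracket x x ∈ part (L := L) 0 := by
  have h := bracket_mem a a x x hx hx
  rwa [CharTwo.add_self_eq_zero] at h

variable [IsLieSuperalgebra L]

theorem bracket_bracket_self_of_odd {x : L} (hx : x ∈ part (L := L) 1) (y : L) :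
    bracket (bracket x x) y = (2 : ℂ) • bracket x (bracket x y) := by
  have h := IsLieSuperalgebra.jacobi 1 1 x x y hx hx
  rw [superSign_one_one] at h
  rw [two_smul]
  nth_rewrite 1 [h]
  module

/-- For odd `x`, the Jacobi identity gives `[[x, x], x] = 2 [x, [x, x]]` while skew-symmetry gives
`-[x, [x, x]]`, and three is invertible. -/
theorem bracket_bracket_self {a : ZMod 2} {x : L} (hx : x ∈ part (L := L) a) :
    bracket x (bracket x x) = 0 := by
  rcases zmod_two_cases a with rfl | rfl
  · rw [bracket_self_even hx, map_zero]
  · have h := bracket_bracket_self_of_odd hx x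
    rw [skew_even (bracket_self_mem hx), neg_eq_iff_add_eq_zero, ← one_smul ℂ (bracket x _),
      smul_smul, ← add_smul] at h
    exact (smul_eq_zero.mp h).resolve_left (by norm_num)

theorem pow_bracket_eq_zero {z : L} (hz : z ∈ part (L := L) 0) (n : ℕ) :
    ∀ (k l : ℕ) (x y : L), k + l = n → ((bracket z : Module.End ℂ L) ^ k) x = 0 →
      ((bracket z : Module.End ℂ L) ^ l) y = 0 →
        ((bracket z : Module.End ℂ L) ^ n) (bracket x y) = 0 := by
  induction n with
  | zero =>
    intro k l x y h hx _
    obtain rfl : k = 0 := by omega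
    rw [pow_zero, Module.End.one_apply] at hx
    simp [hx]
  | succ n ih =>
    intro k l x y h hx hy
    rcases k with _ | k
    · rw [pow_zero, Module.End.one_apply] at hx
      simp [hx]
    rcases l with _ | l
    · rw [pow_zero, Module.End.one_apply] at hy
      simp [hy]
    rw [pow_succ, Module.End.mul_apply, jacobi_even hz, map_add,
      ih k (l + 1) _ _ (by omega) (by rwa [pow_succ, Module.End.mul_apply] at hx) hy,
      ih (k + 1) l _ _ (by omega) hx (by rwa [pow_succ, Module.End.mul_apply] at hy), add_zero]

theorem mem_maxGenEigenspace_zero {V : Type*} [AddCommGroup V] [Module ℂ V]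
    {D : Module.End ℂ V} {x : V} : x ∈ D.maxGenEigenspace 0 ↔ ∃ k, (D ^ k) x = 0 := by
  simp [Module.End.mem_maxGenEigenspace]

theorem bracket_mem_maxGenEigenspace {z : L} (hz : z ∈ part (L := L) 0) {x y : L}
    (hx : x ∈ Module.End.maxGenEigenspace (bracket z : Module.End ℂ L) 0)
    (hy : y ∈ Module.End.maxGenEigenspace (bracket z : Module.End ℂ L) 0) :
    bracket x y ∈ Module.End.maxGenEigenspace (bracket z : Module.End ℂ L) 0 := by
  rw [mem_maxGenEigenspace_zero] at hx hy ⊢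
  obtain ⟨k, hk⟩ := hx
  obtain ⟨l, hl⟩ := hy
  exact ⟨k + l, pow_bracket_eq_zero hz _ k l x y rfl hk hl⟩

/-- An even element, or the square of an odd element, whose adjoint operator is nilpotent at the
same elements as that of `x`. -/
theorem exists_even_of_mem_part {a : ZMod 2} {x : L} (hx : x ∈ part (L := L) a) :
    ∃ z ∈ part (L := L) 0, ∀ y, y ∈ Module.End.maxGenEigenspace (bracket z : Module.End ℂ L) 0 ↔
      y ∈ Module.End.maxGenEigenspace (bracket x : Module.End ℂ L) 0 := by
  rcases zmod_two_cases a with rfl | rfl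
  · exact ⟨x, hx, fun _ => Iff.rfl⟩
  · refine ⟨bracket x x, bracket_self_mem hx, fun y => ?_⟩
    have e : (bracket (bracket x x) : Module.End ℂ L) =
        (2 : ℂ) • (bracket x : Module.End ℂ L) ^ 2 :=
      LinearMap.ext fun y => by
        rw [bracket_bracket_self_of_odd hx, LinearMap.smul_apply, pow_two, Module.End.mul_apply]
    have ek : ∀ k, (bracket (bracket x x) : Module.End ℂ L) ^ k =
        ((2 : ℂ) ^ k) • (bracket x : Module.End ℂ L) ^ (2 * k) := fun k => by
      rw [e, smul_pow, pow_mul]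
    rw [mem_maxGenEigenspace_zero, mem_maxGenEigenspace_zero]
    constructor
    · rintro ⟨k, hk⟩
      rw [ek, LinearMap.smul_apply] at hk
      exact ⟨2 * k, (smul_eq_zero.mp hk).resolve_left (pow_ne_zero _ two_ne_zero)⟩
    · rintro ⟨k, hk⟩
      refine ⟨k, ?_⟩
      rw [ek, two_mul, pow_add, LinearMap.smul_apply, Module.End.mul_apply, hk, map_zero,
        smul_zero]

end Superalgebra

/-! ### Root strings of the generators -/

namespace Contragredient

open Superalgebra

variable {ι : Type*} [Fintype ι] {A : Matrix ι ι ℂ} {H : Type*} [AddCommGroup H] [Module ℂ H]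
  {p : ι → ZMod 2} {R : Realization A H}

namespace G

theorem X_mem_part (i : ι) : X p R i ∈ part (L := G p R) (p i) := (isQuot p R).X_mem i

theorem Y_mem_part (i : ι) : Y p R i ∈ part (L := G p R) (p i) := (isQuot p R).Y_mem i

theorem cartan_mem_part (v : H) : cartan p R v ∈ part (L := G p R) 0 := (isQuot p R).h_mem v

theorem bracket_cartan_X (v : H) (i : ι) :
    bracket (cartan p R v) (X p R i) = R.root i v • X p R i := (isQuot p R).h_X v i

theorem bracket_cartan_Y (v : H) (i : ι) :
    bracket (cartan p R v) (Y p R i) = -R.root i v • Y p R i := (isQuot p R).h_Y v i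

theorem bracket_X_cartan (i : ι) (v : H) :
    bracket (X p R i) (cartan p R v) = -R.root i v • X p R i := by
  rw [← neg_neg (bracket _ _), ← skew_even (cartan_mem_part v), bracket_cartan_X, neg_smul]

theorem bracket_X_Y (i : ι) : bracket (X p R i) (Y p R i) = cartan p R (R.coroot i) :=
  (isQuot p R).X_Y i

theorem bracket_X_Y_of_ne {i j : ι} (hij : i ≠ j) : bracket (X p R i) (Y p R j) = 0 :=
  (isQuot p R).X_Y_ne hij

theorem bracket_Y_X (i : ι) : bracket (Y p R i) (X p R i) =
    cartan p R (-superSign (p i) (p i) • R.coroot i) := by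
  rw [IsLieSuperalgebra.skew _ _ _ _ (Y_mem_part i) (X_mem_part i), bracket_X_Y, map_smul, neg_smul]

theorem bracket_Y_X_of_ne {i j : ι} (hij : i ≠ j) : bracket (Y p R i) (X p R j) = 0 := by
  rw [IsLieSuperalgebra.skew _ _ _ _ (Y_mem_part i) (X_mem_part j), bracket_X_Y_of_ne hij.symm,
    smul_zero, neg_zero]

theorem bracket_Y_bracket_X {i k : ι} (hik : k ≠ i) (w : G p R) :
    bracket (Y p R k) (bracket (X p R i) w) =
      superSign (p k) (p i) • bracket (X p R i) (bracket (Y p R k) w) := by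
  rw [IsLieSuperalgebra.jacobi _ _ _ _ _ (Y_mem_part k) (X_mem_part i), bracket_Y_X_of_ne hik,
    map_zero, LinearMap.zero_apply, zero_add]

theorem X_mem_rootSpace [DecidableEq ι] (i : ι) :
    X p R i ∈ rootSpace p R (wt R (Pi.single i 1)) := fun v => by
  rw [bracket_cartan_X, wt_single, one_smul]

/-- The root string `(ad Xᵢ)ⁿ Xⱼ`. -/
def string (p : ι → ZMod 2) (R : Realization A H) (i j : ι) (n : ℕ) : G p R :=
  ((bracket (X p R i) : Module.End ℂ (G p R)) ^ n) (X p R j)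

theorem string_zero (i j : ι) : string p R i j 0 = X p R j := rfl

theorem string_succ (i j : ι) (n : ℕ) :
    string p R i j (n + 1) = bracket (X p R i) (string p R i j n) := by
  rw [string, pow_succ', Module.End.mul_apply, string]

theorem string_mem_part (i j : ι) (n : ℕ) : ∃ a, string p R i j n ∈ part (L := G p R) a := by
  induction n with
  | zero => exact ⟨_, X_mem_part j⟩
  | succ n ih =>
    obtain ⟨a, ha⟩ := ih
    rw [string_succ]
    exact ⟨_, bracket_mem _ _ _ _ (X_mem_part i) ha⟩

theorem string_mem_rootSpace [DecidableEq ι] (i j : ι) (n : ℕ) : string p R i j n ∈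
    rootSpace p R (wt R (Pi.single j 1 + n • Pi.single i 1)) := by
  induction n with
  | zero =>
    rw [zero_smul, add_zero]
    exact X_mem_rootSpace j
  | succ n ih =>
    rw [string_succ, succ_nsmul, ← add_assoc, wt_add, add_comm]
    exact bracket_mem_rootSpace (X_mem_rootSpace i) ih

theorem bracket_Y_string_of_ne {i j k : ι} (hki : k ≠ i) (n : ℕ) :
    ∃ z : ℂ, bracket (Y p R k) (string p R i j n) = z •
      ((bracket (X p R i) : Module.End ℂ (G p R)) ^ n) (bracket (Y p R k) (X p R j)) := by
  induction n with
  | zero => exact ⟨1, by rw [one_smul]; rfl⟩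
  | succ n ih =>
    obtain ⟨z, hz⟩ := ih
    refine ⟨superSign (p k) (p i) * z, ?_⟩
    rw [string_succ, bracket_Y_bracket_X hki, hz, map_smul, smul_smul, pow_succ',
      Module.End.mul_apply]

/-- For `k` other than `i` and `j`, `Yₖ` moves through the string up to sign and kills its base, so
`eq_zero_of_bracket_Y` needs only two conditions. -/
theorem string_eq_zero {i j : ι} {n : ℕ}
    (hi : bracket (Y p R i) (string p R i j n) = 0)
    (hj : bracket (Y p R j) (string p R i j n) = 0) : string p R i j n = 0 := by
  classical
  obtain ⟨a, ha⟩ := string_mem_part (p := p) (R := R) i j n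
  refine eq_zero_of_bracket_Y ha (string_mem_rootSpace i j n) ?_ fun k => ?_
  · simp only [Pi.add_apply, Finset.sum_add_distrib, nsmul_eq_mul, Pi.mul_apply, Pi.natCast_apply,
      ← Finset.mul_sum, Finset.sum_pi_single', Finset.mem_univ, if_true]
    positivity
  · by_cases hki : k = i
    · rw [hki, hi]
    by_cases hkj : k = j
    · rw [hkj, hj]
    obtain ⟨z, hz⟩ := bracket_Y_string_of_ne (p := p) (R := R) (j := j) hki n
    rw [hz, bracket_Y_X_of_ne hkj, map_zero, smul_zero]

theorem pow_bracket_X_cartan (i : ι) (v : H) (n : ℕ) :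
    ((bracket (X p R i) : Module.End ℂ (G p R)) ^ (n + 3)) (cartan p R v) = 0 := by
  rw [pow_add, Module.End.mul_apply, pow_succ, pow_two, Module.End.mul_apply, Module.End.mul_apply,
    bracket_X_cartan, map_smul, map_smul, bracket_bracket_self (X_mem_part i), smul_zero, map_zero]

theorem pow_bracket_X_cartan_of_even {i : ι} (hi : p i = 0) (v : H) (n : ℕ) :
    ((bracket (X p R i) : Module.End ℂ (G p R)) ^ (n + 2)) (cartan p R v) = 0 := by
  have hX := X_mem_part (p := p) (R := R) i
  rw [hi] at hX
  rw [pow_add, Module.End.mul_apply, pow_two, Module.End.mul_apply,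
    bracket_X_cartan, map_smul, bracket_self_even hX, smul_zero, map_zero]

/-- The coefficients enter through their recursion, since their closed forms differ between even and
odd `i`. -/
theorem bracket_Y_string_self {i j : ι} (hij : i ≠ j) {z : ℕ → ℂ}
    (h0 : z 0 = -superSign (p i) (p i) * A i j)
    (hz : ∀ n, z (n + 1) = superSign (p i) (p i) * (z n - (A i j + (n + 1) * A i i))) (n : ℕ) :
    bracket (Y p R i) (string p R i j (n + 1)) = z n • string p R i j n := by
  classical
  have hh : ∀ n : ℕ, bracket (bracket (Y p R i) (X p R i)) (string p R i j n) =
      (-superSign (p i) (p i) * (A i j + n * A i i)) • string p R i j n := fun n => by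
    rw [bracket_Y_X, string_mem_rootSpace i j n, wt_add, wt_nsmul, wt_single, wt_single, map_smul,
      smul_eq_mul, LinearMap.add_apply, LinearMap.smul_apply, one_smul, one_smul, R.root_coroot,
      ← Nat.cast_smul_eq_nsmul ℂ n (R.root i), LinearMap.smul_apply, R.root_coroot, smul_eq_mul]
  induction n with
  | zero =>
    rw [string_succ, IsLieSuperalgebra.jacobi _ _ _ _ _ (Y_mem_part i) (X_mem_part i), hh,
      string_zero, bracket_Y_X_of_ne hij, h0]
    simp
  | succ n ih =>
    rw [string_succ, IsLieSuperalgebra.jacobi _ _ _ _ _ (Y_mem_part i) (X_mem_part i), hh, ih,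
      map_smul, ← string_succ, hz]
    push_cast
    module

theorem string_one_eq_zero {i j : ι} (hij : i ≠ j) (ha : A i j = 0) (hb : A j i = 0) :
    string p R i j 1 = 0 := by
  refine string_eq_zero ?_ ?_
  · rw [string_succ, string_zero,
      IsLieSuperalgebra.jacobi _ _ _ _ _ (Y_mem_part i) (X_mem_part i), bracket_Y_X,
      bracket_cartan_X, bracket_Y_X_of_ne hij]
    simp [R.root_coroot, ha]
  · rw [string_succ, string_zero, bracket_Y_bracket_X hij.symm, bracket_Y_X, bracket_X_cartan]
    simp [R.root_coroot, hb]

/-- The coefficient of `Yᵢ` vanishes at `n = l + 1`, as for `sl₂`. The length is at least two, so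
`Yⱼ` also kills the vector, because `(ad Xᵢ)²` is zero on the Cartan part. -/
theorem string_eq_zero_of_even {i j : ι} (hij : i ≠ j) (hi : p i = 0) {l : ℕ}
    (h : A i j + (l + 1) * A i i / 2 = 0) : string p R i j (l + 2) = 0 := by
  refine string_eq_zero ?_ ?_
  · rw [bracket_Y_string_self (z := fun n => -((n + 1) * (A i j + n * A i i / 2))) hij]
    · push_cast
      rw [h]
      simp
    · simp [hi, superSign_zero_left]
    · intro n
      simp only [hi, superSign_zero_left]
      push_cast
      ring
  · obtain ⟨z, hz⟩ := bracket_Y_string_of_ne (p := p) (R := R) (j := j) hij.symm (l + 2)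
    rw [hz, bracket_Y_X, pow_bracket_X_cartan_of_even hi, smul_zero]

/-- For odd `i` the coefficients alternate between two progressions, and the even-indexed one
vanishes at `n = 2 * l + 2`. The length is at least three, as required for `(ad Xᵢ)³` to kill the
Cartan part. -/
theorem string_eq_zero_of_odd {i j : ι} (hij : i ≠ j) (hi : p i = 1) {l : ℕ}
    (h : A i j + (l + 1) * A i i = 0) : string p R i j (2 * l + 3) = 0 := by
  refine string_eq_zero ?_ ?_
  · rw [bracket_Y_string_self (z := fun n => if Even n then A i j + (n / 2) * A i i
      else ((n + 1) / 2) * A i i) hij]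
    · have : Even (2 * l + 2) := ⟨l + 1, by ring⟩
      rw [if_pos this]
      push_cast
      rw [show ((2 : ℂ) * l + 2) / 2 = l + 1 by ring, h, zero_smul]
    · simp [hi, superSign_one_one]
    · intro n
      rw [hi, superSign_one_one]
      by_cases hn : Even n
      · rw [if_pos hn, if_neg (by rwa [Nat.not_even_iff_odd, Nat.odd_add_one,
          Nat.not_odd_iff_even])]
        push_cast
        ring
      · rw [if_neg hn, if_pos (by rwa [Nat.even_add_one])]
        push_cast
        ring
  · obtain ⟨z, hz⟩ := bracket_Y_string_of_ne (p := p) (R := R) (j := j) hij.symm (2 * l + 3)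
    rw [hz, bracket_Y_X, pow_bracket_X_cartan, smul_zero]

theorem bracket_X_X_eq_zero {i : ι} (hi : A i i = 0) : bracket (X p R i) (X p R i) = 0 := by
  classical
  refine eq_zero_of_bracket_Y (c := Pi.single i 1 + Pi.single i 1)
    (bracket_self_mem (X_mem_part i)) ?_ ?_ fun k => ?_
  · rw [wt_add]
    exact bracket_mem_rootSpace (X_mem_rootSpace i) (X_mem_rootSpace i)
  · simp [Finset.sum_add_distrib]
  · by_cases hk : k = i
    · subst hk
      rw [IsLieSuperalgebra.jacobi _ _ _ _ _ (Y_mem_part k) (X_mem_part k), bracket_Y_X,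
        bracket_cartan_X, bracket_X_cartan]
      simp [R.root_coroot, hi]
    · rw [bracket_Y_bracket_X hk, bracket_Y_X_of_ne hk, map_zero, smul_zero]

end G

end Contragredient

/-! ### Ladders in `g(A)` and termination of root strings -/

namespace Contragredient

open Superalgebra

/-- One term dominates for large `k` and `n`: `k n b c` if `b` and `c` are nonzero, and `(n + k t) a
b` if only `c` is zero, where `hc` forces `a ≠ 0`. For `b = 0` only `a t d` remains. -/
theorem exists_forall_ge_ne_zero {a b c d : ℂ} (hc : ∀ l : ℕ, a + (l + 1) * c / 2 ≠ 0)
    (h : b ≠ 0 ∨ a ≠ 0 ∧ d ≠ 0) (T : ℕ) : ∃ K : ℕ, 1 ≤ K ∧ ∀ k n t : ℕ, K ≤ k → K ≤ n → 1 ≤ t →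
      t ≤ T → a * (t * d + n * b) + k * b * (t * a + n * c) ≠ 0 := by
  by_cases hb : b = 0
  · obtain ⟨ha, hd⟩ := h.resolve_left (not_not.mpr hb)
    refine ⟨1, le_rfl, fun k n t _ _ ht _ => ?_⟩
    have ht' : (t : ℂ) ≠ 0 := Nat.cast_ne_zero.mpr (by omega)
    simpa [hb] using ⟨ha, by omega, hd⟩
  by_cases hc0 : c = 0
  · have ha : a ≠ 0 := by simpa [hc0] using hc 0
    obtain ⟨K, hK⟩ := exists_nat_gt (T * ‖d‖ / ‖b‖)
    rw [div_lt_iff₀ (norm_pos_iff.mpr hb)] at hK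
    refine ⟨K + 1, by omega, fun k n t hk hn ht htT e => ?_⟩
    have e1 : ((n + k * t : ℕ) : ℂ) * b = -(t * d) := by
      have : a * (t * d + (n + k * t : ℕ) * b) = 0 := by
        rw [← e, hc0]
        push_cast
        ring
      have := (mul_eq_zero.mp this).resolve_left ha
      exact eq_neg_of_add_eq_zero_right this
    have e2 := congrArg norm e1
    rw [norm_mul, norm_neg, norm_mul, Complex.norm_natCast, Complex.norm_natCast] at e2
    have h1 : (K : ℝ) ≤ (n + k * t : ℕ) := by
      have : K ≤ n + k * t := by omega
      exact_mod_cast this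
    have h2 : (t : ℝ) ≤ T := by exact_mod_cast htT
    have h3 := mul_le_mul_of_nonneg_right h1 (norm_nonneg b)
    have h4 := mul_le_mul_of_nonneg_right h2 (norm_nonneg d)
    linarith
  · set M : ℝ := T * ‖a * d‖ + ‖a * b‖ + T * ‖a * b‖ with hM
    have hbc : 0 < ‖b * c‖ := norm_pos_iff.mpr (mul_ne_zero hb hc0)
    obtain ⟨K, hK⟩ := exists_nat_gt (M / ‖b * c‖)
    rw [div_lt_iff₀ hbc] at hK
    refine ⟨K + 1, by omega, fun k n t hk hn ht htT e => ?_⟩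
    have e1 : ((k * n : ℕ) : ℂ) * (b * c) =
        -((t : ℂ) * (a * d) + (n : ℂ) * (a * b) + ((k * t : ℕ) : ℂ) * (a * b)) := by
      rw [eq_neg_iff_add_eq_zero, ← e]
      push_cast
      ring
    have e2 : ((k * n : ℕ) : ℝ) * ‖b * c‖ ≤
        t * ‖a * d‖ + n * ‖a * b‖ + (k * t : ℕ) * ‖a * b‖ := by
      have := congrArg norm e1
      rw [norm_mul, norm_neg, Complex.norm_natCast] at this
      rw [this]
      refine (norm_add₃_le).trans (le_of_eq ?_)
      rw [norm_mul (t : ℂ), norm_mul (n : ℂ), norm_mul ((k * t : ℕ) : ℂ), Complex.norm_natCast,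
        Complex.norm_natCast, Complex.norm_natCast]
    have hkn : 0 < k * n := Nat.mul_pos (by omega) (by omega)
    have f1 : K * t ≤ k * n * T := by
      calc K * t ≤ (k * n) * T := Nat.mul_le_mul
            ((by omega : K ≤ k).trans (Nat.le_mul_of_pos_right k (by omega))) htT
        _ = _ := rfl
    have f2 : K * n ≤ k * n := Nat.mul_le_mul_right n (by omega)
    have f3 : K * (k * t) ≤ k * n * T := by
      calc K * (k * t) ≤ n * (k * T) := Nat.mul_le_mul (by omega) (Nat.mul_le_mul_left k htT)
        _ = _ := by ring
    have g1 : (K : ℝ) * t ≤ (k * n : ℕ) * T := by exact_mod_cast f1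
    have g2 : (K : ℝ) * n ≤ (k * n : ℕ) := by exact_mod_cast f2
    have g3 : (K : ℝ) * (k * t : ℕ) ≤ (k * n : ℕ) * T := by exact_mod_cast f3
    have h0 := mul_le_mul_of_nonneg_left e2 K.cast_nonneg (α := ℝ)
    have h1 := mul_le_mul_of_nonneg_right g1 (norm_nonneg (a * d))
    have h2 := mul_le_mul_of_nonneg_right g2 (norm_nonneg (a * b))
    have h3 := mul_le_mul_of_nonneg_right g3 (norm_nonneg (a * b))
    have h4 := mul_lt_mul_of_pos_left hK (show (0 : ℝ) < (k * n : ℕ) by exact_mod_cast hkn)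
    rw [hM] at h4
    linarith

variable {ι : Type*} [Fintype ι] {A : Matrix ι ι ℂ} {H : Type*} [AddCommGroup H] [Module ℂ H]
  {p : ι → ZMod 2} {R : Realization A H}

/-- The ladder of the simple root `αⱼ` over an even `sl₂`-triple or Heisenberg triple proportional
to the root `αᵢ`. -/
def ladder {i j : ι} {N : ℕ} {X Y : G p R} (hX : X ∈ part (L := G p R) 0)
    (hY : Y ∈ part (L := G p R) 0) (hXY : bracket X Y = G.cartan p R (R.coroot i))
    (hXw : X ∈ rootSpace p R (N • R.root i)) (hYw : Y ∈ rootSpace p R (-(N • R.root i)))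
    (hXj : bracket X (G.Y p R j) = 0) (hYj : bracket Y (G.X p R j) = 0) :
    Ladder (G p R) (A i j) (-superSign (p j) (p j) * (N * A j i)) (N * A i i) (p j) where
  X := X
  Y := Y
  h := G.cartan p R (R.coroot i)
  e := G.X p R j
  f := G.Y p R j
  k := G.cartan p R (-superSign (p j) (p j) • R.coroot j)
  X_mem := hX
  Y_mem := hY
  e_mem := G.X_mem_part j
  f_mem := G.Y_mem_part j
  X_Y := hXY
  f_e := G.bracket_Y_X j
  Y_e := hYj
  X_f := hXj
  h_X := by
    rw [hXw, ← Nat.cast_smul_eq_nsmul ℂ, LinearMap.smul_apply, R.root_coroot, smul_eq_mul]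
  h_Y := by
    rw [hYw, ← Nat.cast_smul_eq_nsmul ℂ, LinearMap.neg_apply, LinearMap.smul_apply, R.root_coroot,
      smul_eq_mul]
  h_e := by rw [G.bracket_cartan_X, R.root_coroot]
  h_f := by rw [G.bracket_cartan_Y, R.root_coroot]
  k_X := by
    rw [hXw, ← Nat.cast_smul_eq_nsmul ℂ, LinearMap.smul_apply, map_smul, R.root_coroot,
      smul_eq_mul, smul_eq_mul]
    congr 1
    ring
  k_Y := by
    rw [hYw, ← Nat.cast_smul_eq_nsmul ℂ, LinearMap.neg_apply, LinearMap.smul_apply, map_smul,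
      R.root_coroot, smul_eq_mul, smul_eq_mul]
    congr 1
    ring

theorem not_finiteGrowth_of_triple (hA : ∀ i, ∃ j, A i j ≠ 0) {i j : ι} (hij : i ≠ j) {N : ℕ}
    (hN : N ≠ 0) {X Y : G p R} (hX : X ∈ part (L := G p R) 0)
    (hY : Y ∈ part (L := G p R) 0) (hXY : bracket X Y = G.cartan p R (R.coroot i))
    (hXw : X ∈ rootSpace p R (N • R.root i)) (hYw : Y ∈ rootSpace p R (-(N • R.root i)))
    (hXj : bracket X (G.Y p R j) = 0) (hYm : ∀ m, m ≠ i → bracket Y (G.X p R m) = 0)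
    (hc : ∀ l : ℕ, A i j + (l + 1) * (N * A i i) / 2 ≠ 0) (hab : ¬ (A i j = 0 ∧ A j i = 0))
    (h1 : bracket X (G.X p R j) ≠ 0) : ¬ FiniteGrowth p R := by
  classical
  set S := ladder hX hY hXY hXw hYw hXj (hYm j hij.symm) with hS
  have hXw' : S.X ∈ rootSpace p R (wt R (Pi.single i (N : ℤ))) := by
    rw [wt_single, Nat.cast_smul_eq_nsmul]
    exact hXw
  have hew : S.e ∈ rootSpace p R (wt R (Pi.single j 1)) := G.X_mem_rootSpace j
  have hs := superSign_ne_zero (p j) (p j)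
  refine not_finiteGrowth_of_ladder S hc rfl rfl hXw' hew (nX := N) (ne := 1)
    (by simp) (by simp) fun s => ?_
  have hval : ∀ (c : ι → ℤ) (k : ℕ), wt R c (A i j • (-superSign (p j) (p j) • R.coroot j) +
      ((k : ℂ) * (-superSign (p j) (p j) * (N * A j i))) • R.coroot i) =
        -superSign (p j) (p j) * (A i j * wt R c (R.coroot j) +
          k * (N * A j i) * wt R c (R.coroot i)) := fun c k => by
    simp only [map_add, map_smul, smul_eq_mul]
    ring
  have hwt : ∀ (c : ι → ℤ) (t n : ℕ) (v : H),
      wt R (c + t • Pi.single j 1 + n • Pi.single i (N : ℤ)) v =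
        wt R c v + t * R.root j v + n * (N * R.root i v) := fun c t n v => by
    rw [wt_add, wt_add, wt_nsmul, wt_nsmul, wt_single, wt_single, one_smul,
      Nat.cast_smul_eq_nsmul, ← Nat.cast_smul_eq_nsmul ℂ, ← Nat.cast_smul_eq_nsmul ℂ,
      ← Nat.cast_smul_eq_nsmul ℂ]
    simp only [LinearMap.add_apply, LinearMap.smul_apply, smul_eq_mul]
  have hN' : (N : ℂ) ≠ 0 := Nat.cast_ne_zero.mpr hN
  by_cases hcase : A j i = 0 ∧ A j j = 0
  -- Here `αᵢ` and `αⱼ` vanish on `hⱼ`, so words in the string have no weight there. The nonzero row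
  -- `j` provides an `Xₘ` as starting vector, and the scalars become multiples of `aᵢⱼ aⱼₘ`.
  · obtain ⟨hb, hd⟩ := hcase
    have ha : A i j ≠ 0 := fun h => hab ⟨h, hb⟩
    obtain ⟨m, hm⟩ := hA j
    have hmi : m ≠ i := fun h => hm (h ▸ hb)
    have hmj : m ≠ j := fun h => hm (h ▸ hd)
    refine ⟨G.X p R m, Pi.single m 1, 0, 1, G.X_ne_zero m, G.X_mem_rootSpace m, by simp,
      fun k hk => ?_, fun t _ k _ n => ?_⟩
    · clear hk
      induction k with
      | zero => exact G.bracket_Y_X_of_ne hmj.symm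
      | succ k ih =>
        have hm0 : bracket S.Y (G.X p R m) = 0 := hYm m hmi
        have h := jacobi_even S.Y_mem (S.down k) (G.X p R m)
        rw [ih, hm0, map_zero, map_zero, add_zero] at h
        rw [S.down_succ, ← h]
    · rw [hval, hwt, wt_single, one_smul, R.root_coroot, R.root_coroot, R.root_coroot, hb, hd]
      simpa [hs] using ⟨ha, hm⟩
  · have hbd : (N * A j i : ℂ) ≠ 0 ∨ A i j ≠ 0 ∧ A j j ≠ 0 := by
      by_cases hb : A j i = 0
      · exact Or.inr ⟨fun h => hab ⟨h, hb⟩, fun h => hcase ⟨hb, h⟩⟩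
      · exact Or.inl (mul_ne_zero hN' hb)
    -- The starting vector is `up K`; it contributes one further `αⱼ`, so the multiplicities `t + 1`
    -- with `t < s` must be covered.
    obtain ⟨K, hK1, hK⟩ := exists_forall_ge_ne_zero hc hbd (s + 1)
    -- Nonvanishing climbs the string because `ad Y` sends each member to a nonzero multiple of the
    -- preceding one.
    have hup : ∀ k, S.up (k + 1) ≠ 0 := by
      intro k
      induction k with
      | zero => exact h1
      | succ k ih =>
        intro h
        have h' := S.Y_up (k + 1)
        rw [h, map_zero, eq_comm, neg_smul, neg_eq_zero] at h'
        refine (smul_eq_zero.mp h').elim (fun h'' => ?_) ih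
        rw [Ladder.coeff, mul_eq_zero] at h''
        refine h''.elim (by exact_mod_cast Nat.succ_ne_zero (k + 1)) fun h3 => hc k ?_
        push_cast at h3
        exact h3
    obtain ⟨K', rfl⟩ := Nat.exists_eq_add_of_le' hK1
    refine ⟨S.up (K' + 1), _, K' + 1 + 1, 1 + (K' + 1) * N, hup K',
      up_mem_rootSpace S hXw' hew (K' + 1), ?_,
      fun k hk => S.down_up_eq_zero (Or.inr (by omega)), fun t ht k hk n => ?_⟩
    · simp [Finset.sum_add_distrib, ← Finset.mul_sum]
    · have e : (Pi.single j 1 + (K' + 1) • Pi.single i (N : ℤ) + t • Pi.single j 1 +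
          n • Pi.single i (N : ℤ) : ι → ℤ) =
          0 + (t + 1) • Pi.single j 1 + (K' + 1 + n) • Pi.single i (N : ℤ) := by module
      have h0 : wt R 0 = 0 := by simp [wt]
      rw [e, hval, hwt, hwt, h0, R.root_coroot, R.root_coroot, R.root_coroot, R.root_coroot]
      refine mul_ne_zero (neg_ne_zero.mpr hs) ?_
      have := hK k (K' + 1 + n) (t + 1) (by omega) (by omega) (by omega) (by omega)
      simpa using this

theorem FiniteGrowth.exists_string_eq_zero (hfg : FiniteGrowth p R) (hA : ∀ i, ∃ j, A i j ≠ 0)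
    {i j : ι} (hij : i ≠ j) : ∃ n, G.string p R i j n = 0 := by
  classical
  by_cases hab : A i j = 0 ∧ A j i = 0
  · exact ⟨1, G.string_one_eq_zero hij hab.1 hab.2⟩
  have hXi : G.X p R i ∈ rootSpace p R (R.root i) := fun v => G.bracket_cartan_X v i
  have hYi : G.Y p R i ∈ rootSpace p R (-R.root i) := fun v => G.bracket_cartan_Y v i
  rcases zmod_two_cases (p i) with hi | hi
  · by_contra! hne
    have hc : ∀ l : ℕ, A i j + (l + 1) * ((1 : ℕ) * A i i) / 2 ≠ 0 := fun l hl => by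
      rw [Nat.cast_one, one_mul] at hl
      exact hne _ (G.string_eq_zero_of_even hij hi hl)
    exact not_finiteGrowth_of_triple hA hij one_ne_zero (hi ▸ G.X_mem_part i)
      (hi ▸ G.Y_mem_part i) (G.bracket_X_Y i) (by rwa [one_smul]) (by rwa [one_smul])
      (G.bracket_X_Y_of_ne hij) (fun m hm => G.bracket_Y_X_of_ne hm.symm) hc hab (hne 1) hfg
  · have hX := G.X_mem_part (p := p) (R := R) i
    have hY := G.Y_mem_part (p := p) (R := R) i
    rw [hi] at hX hY
    have hsq : ∀ w, bracket (bracket (G.X p R i) (G.X p R i)) w =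
        (2 : ℂ) • bracket (G.X p R i) (bracket (G.X p R i) w) := bracket_bracket_self_of_odd hX
    by_cases hii : A i i = 0
    · refine ⟨2, ?_⟩
      have h := hsq (G.X p R j)
      rw [G.bracket_X_X_eq_zero hii, map_zero, LinearMap.zero_apply, eq_comm] at h
      exact (smul_eq_zero.mp h).resolve_left two_ne_zero
    · by_contra! hne
      have hc : ∀ l : ℕ, A i j + (l + 1) * ((2 : ℕ) * A i i) / 2 ≠ 0 := fun l hl => by
        refine hne _ (G.string_eq_zero_of_odd hij hi (l := l) ?_)
        rw [← hl]
        push_cast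
        ring
      have hYX : bracket (G.Y p R i) (G.X p R i) = G.cartan p R (R.coroot i) := by
        rw [G.bracket_Y_X, hi, superSign_one_one, neg_neg, one_smul]
      have hZY : bracket (bracket (G.X p R i) (G.X p R i)) (G.Y p R i) =
          (-(2 * A i i)) • G.X p R i := by
        rw [hsq, G.bracket_X_Y, G.bracket_X_cartan, R.root_coroot]
        module
      -- The normalization comes from `[[Xᵢ, Xᵢ], [Yᵢ, Yᵢ]] = -4 aᵢᵢ hᵢ`.
      have hZW : bracket (bracket (G.X p R i) (G.X p R i))
          ((-(4 * A i i)⁻¹) • bracket (G.Y p R i) (G.Y p R i)) = G.cartan p R (R.coroot i) := by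
        rw [map_smul, jacobi_even (bracket_self_mem hX), hZY, map_smul, map_smul,
          LinearMap.smul_apply, G.bracket_X_Y, hYX, ← add_smul, smul_smul]
        convert one_smul ℂ _ using 2
        field_simp
        ring
      have hYm : ∀ m, m ≠ i → bracket ((-(4 * A i i)⁻¹) • bracket (G.Y p R i) (G.Y p R i))
          (G.X p R m) = 0 := fun m hm => by
        rw [map_smul, LinearMap.smul_apply, bracket_bracket_self_of_odd hY,
          G.bracket_Y_X_of_ne hm.symm, map_zero, smul_zero, smul_zero]
      refine not_finiteGrowth_of_triple hA hij two_ne_zero (bracket_self_mem hX)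
        (Submodule.smul_mem _ _ (bracket_self_mem hY)) hZW ?_ ?_ ?_ hYm hc hab ?_ hfg
      · rw [two_smul]
        exact bracket_mem_rootSpace hXi hXi
      · rw [two_smul, neg_add]
        exact Submodule.smul_mem _ _ (bracket_mem_rootSpace hYi hYi)
      · rw [hsq, G.bracket_X_Y_of_ne hij, map_zero, smul_zero]
      · rw [hsq]
        exact smul_ne_zero two_ne_zero (hne 2)

end Contragredient

end

/-! ### Reduction of integrability to root strings -/

open Superalgebra Contragredient in
theorem mainTheorem3 {ι : Type*} [Fintype ι] (A : Matrix ι ι ℂ) (p : ι → ZMod 2)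
    {H : Type*} [AddCommGroup H] [Module ℂ H] (R : Contragredient.Realization A H)
    (hA : ∀ i, ∃ j, A i j ≠ 0) (hfg : Contragredient.FiniteGrowth p R) :
    Contragredient.Integrable p R := by
  intro i x
  -- Passing to an even `z` makes the adjoint operator a derivation, so its generalized kernel is
  -- closed under brackets and equals `g(A)` once it contains the generators.
  obtain ⟨z, hz, hzX⟩ := exists_even_of_mem_part (G.X_mem_part (p := p) (R := R) i)
  have hcartan : ∀ v, ((bracket (G.X p R i) : Module.End ℂ (G p R)) ^ 3) (G.cartan p R v) = 0 :=
    fun v => G.pow_bracket_X_cartan i v 0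
  have hgen : ∀ g, G.proj p R (Free.gen p H g) ∈
      Module.End.maxGenEigenspace (bracket z : Module.End ℂ (G p R)) 0 := by
    intro g
    rw [hzX, mem_maxGenEigenspace_zero]
    cases g with
    | X j =>
      by_cases hij : i = j
      · subst hij
        refine ⟨2, ?_⟩
        rw [pow_two]
        exact bracket_bracket_self (G.X_mem_part i)
      · exact hfg.exists_string_eq_zero hA hij
    | Y j =>
      by_cases hij : i = j
      · subst hij
        refine ⟨4, ?_⟩
        rw [pow_succ, Module.End.mul_apply]
        exact (congrArg _ (G.bracket_X_Y i)).trans (hcartan _)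
      · refine ⟨1, ?_⟩
        rw [pow_one]
        exact G.bracket_X_Y_of_ne hij
    | h v => exact ⟨3, hcartan v⟩
  have htop := (G.isQuot p R).eq_top hgen fun g y hy => bracket_mem_maxGenEigenspace hz (hgen g) hy
  have hx := (hzX x).mp (htop ▸ Submodule.mem_top)
  obtain ⟨k, hk⟩ := mem_maxGenEigenspace_zero.mp hx
  exact ⟨k, by rw [Module.End.pow_apply] at hk; exact hk⟩
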